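/- **Setting.** Write $\sigma(t)=\max\{t,0\}$ (applied entrywise) and $\|A\|=\max_i\sum_j|a_{ij}|$ for a real matrix $A=(a_{ij})$. For positive integers $d,W,L$ consider weights $\theta=((A_0,b_0),\dots,(A_{L-1},b_{L-1}),A_L)$ of ReLU networks $\phi_\theta:\mathbb R^d\to\mathbb R$ of depth $L$ and width $W=\max\{N_1,\dots,N_L\}$, $$\phi_0(x)=x,\qquad \phi_{\ell+1}(x)=\sigma(A_\ell\phi_\ell(x)+b_\ell)\in\mathbb R^{N_{\ell+1}}\ (0\le\ell<L),\qquad \phi_\theta(x)=A_L\phi_L(x),$$ and let $\kappa(\theta)=\|A_L\|\prod_{\ell=0}^{L-1}\max\{\|(A_\ell,b_\ell)\|,1\}$. For probability measures $\mu,\rho$ on $[0,1]^d$ and $\lambda>0$ let $$d_{W,L,\lambda}(\mu,\rho)=\sup_{\theta}\Big(\mathbb E_\mu[\phi_\theta]-\mathbb E_\rho[\phi_\theta]-\lambda\,\kappa(\theta)^2\Big),$$ the supremum being over all weights $\theta$ of networks of width $W$ and depth $L$, without any constraint on $\kappa(\theta)$. For a class $\mathcal H$ of functions let $d_{\mathcal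 H}(\mu,\rho)=\sup_{h\in\mathcal H}(\mathbb E_\mu[h]-\mathbb E_\rho[h])$; $\mathcal W_1=d_{\mathcal H}$ for the class of functions that are $1$-Lipschitz with respect to $\|\cdot\|_\infty$. For $\alpha=r+\beta$ with $r\in\{0,1,2,\dots\}$ and $\beta\in(0,1]$, $\mathcal H^\alpha$ is the class of restrictions to $[0,1]^d$ of the $C^r$ functions $f:\mathbb R^d\to\mathbb R$ with $|\partial^s f|\le1$ for all $\|s\|_1\le r$ and $|\partial^sf(x)-\partial^sf(y)|\le\|x-y\|_\infty^\beta$ for all $x,y$ and all $\|s\|_1=r$. **Statement.** Let $d\ge1$ and $\alpha=r+\beta>0$ as above. There is $c>0$ such that for all $0<a\le b$ there is $C>0$ (so $c$ depends only on $d,\alpha$, and $C$ only on $d,\alpha,a,b$) with the following property. Let $n\ge1$, and let $K>0$ and integers $W,L$ satisfy $$a\,n^{(d+1)/d}\le K\le b\,n^{(d+1)/d},\qquad W\ge c\,K^{(2d+\alpha)/(2d+2)},\qquad L\ge2\lceil\log_2(d+r)\rceil+2,$$ and put $\lambda=\frac1{4K^2}$, so that $\frac1{4b^2}n^{-2(d+1)/d}\le\lambda\le\frac1{4a^2}n^{-2(d+1)/d}$.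 Let $\nu$ be a probability measure on some $\mathbb R^k$, $\mathcal G$ a class of measurable maps $g:\mathbb R^k\to[0,1]^d$, $\mu$ a probability measure supported on $[0,1]^d$, $X_1,\dots,X_n$ i.i.d. samples from $\mu$, and $\widehat\mu_n=\frac1n\sum_{i=1}^n\delta_{X_i}$. Assume that, almost surely, $\inf_{g\in\mathcal G}\mathcal W_1(\widehat\mu_n,g_\#\nu)=0$. Let $\epsilon_{opt}\ge0$, and let $\widehat g_{n,\lambda}\in\mathcal G$ be any (random) estimator with, almost surely, $$d_{W,L,\lambda}(\widehat\mu_n,(\widehat g_{n,\lambda})_\#\nu)\le\inf_{g\in\mathcal G}d_{W,L,\lambda}(\widehat\mu_n,g_\#\nu)+\epsilon_{opt}$$ for which the error $d_{\mathcal H^\alpha}(\mu,(\widehat g_{n,\lambda})_\#\nu)$ is a random variable (that is, measurable). Then this error is integrable and $$\mathbb E\big[d_{\mathcal H^\alpha}(\mu,(\widehat g_{n,\lambda})_\#\nu)\big]-\sqrt{\epsilon_{opt}}\le C\,\max\big\{n^{-\alpha/d},\;n^{-1/2}(\log n)^\tau\big\},$$ where $\tau=1$ if $2\alpha=d$ and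 $\tau=0$ otherwise. -/

import Mathlib

open MeasureTheory ProbabilityTheory

/-! Throughout, `ℝ^d` is `Fin d → ℝ`, whose norm in Mathlib is the sup norm `‖·‖_∞`. -/

/-- The weights `θ = ((A_0, b_0), …, (A_{L-1}, b_{L-1}), A_L)` of a ReLU network with input
dimension `m` (first index), depth `L`, that is `L` hidden layers (second index), and output
dimension `k`. The hidden layers have arbitrary positive sizes `N_1, …, N_L`. -/
inductive ReLUNet (k : ℕ) : ℕ → ℕ → Type
  | output {m : ℕ} (A : Matrix (Fin k) (Fin m) ℝ) : ReLUNet k m 0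
  | hidden {m L : ℕ} (N : ℕ) (hN : 0 < N) (A : Matrix (Fin N) (Fin m) ℝ) (b : Fin N → ℝ)
      (θ : ReLUNet k N L) : ReLUNet k m (L + 1)

namespace ReLUNet

/-- The function computed by the network: each hidden layer maps `x` to `σ(A x + b)` with
`σ(t) = max t 0` applied entrywise; the output layer maps `x` to `A x`. -/
def eval {k : ℕ} : {m L : ℕ} → ReLUNet k m L → (Fin m → ℝ) → (Fin k → ℝ)
  | _, _, .output A, x => A.mulVec x
  | _, _, .hidden _ _ A b θ, x => θ.eval (fun i => max (A.mulVec x i + b i) 0)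

/-- The width `max {N_1, …, N_L}` (and `0` if there is no hidden layer). -/
def width {k : ℕ} : {m L : ℕ} → ReLUNet k m L → ℕ
  | _, _, .output _ => 0
  | _, _, .hidden N _ _ _ θ => max N θ.width

section

attribute [local instance] Matrix.linftyOpNormedAddCommGroup

/-- `κ(θ) = ‖A_L‖ ∏_{ℓ < L} max {‖(A_ℓ, b_ℓ)‖, 1}`, where `‖·‖` is the operator norm of a matrix
with respect to the sup norms, that is the largest `1`-norm of a row. -/
noncomputable def kappa {k : ℕ} : {m L : ℕ} → ReLUNet k m L → ℝ
  | _, _, .output A => ‖A‖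
  | _, _, .hidden _ _ A b θ =>
      max ‖Matrix.fromCols A (Matrix.replicateCol (Fin 1) b)‖ 1 * θ.kappa

end

/-- The real-valued function `φ_θ` computed by a network with a single output. -/
def toFun {m L : ℕ} (θ : ReLUNet 1 m L) (x : Fin m → ℝ) : ℝ := θ.eval x 0

end ReLUNet

/-- The Hölder class `H^α(ℝ^d)` with `α = r + β`: functions of class `C^r` all of whose partial
derivatives of order at most `r` are bounded by `1`, those of order `r` being moreover
`β`-Hölder with constant `1`. A tuple `i : Fin m → Fin d` stands for the partial derivative
`∂/∂x_{i 0} ⋯ ∂/∂x_{i (m-1)}`; these are exactly the `∂^s` with `‖s‖_1 = m`. -/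
def holderClass (d r : ℕ) (β : ℝ) : Set ((Fin d → ℝ) → ℝ) :=
  {f | ContDiff ℝ r f ∧
    (∀ m : ℕ, m ≤ r → ∀ (i : Fin m → Fin d) (x : Fin d → ℝ),
      |iteratedFDeriv ℝ m f x (fun j => Pi.single (i j) (1 : ℝ))| ≤ 1) ∧
    (∀ (i : Fin r → Fin d) (x y : Fin d → ℝ),
      |iteratedFDeriv ℝ r f x (fun j => Pi.single (i j) (1 : ℝ)) -
        iteratedFDeriv ℝ r f y (fun j => Pi.single (i j) (1 : ℝ))| ≤ ‖x - y‖ ^ β)}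

/-- The integral probability metric `d_F(μ, ν) = sup_{f ∈ F} E_μ[f] - E_ν[f]`. It is applied
below to probability measures carried by `[0,1]^d` and to the classes `holderClass` and Lipschitz
functions, for which the supremum is finite. -/
noncomputable def ipm {d : ℕ} (F : Set ((Fin d → ℝ) → ℝ)) (μ ν : Measure (Fin d → ℝ)) : ℝ :=
  ⨆ f : F, ((∫ x, f.1 x ∂μ) - ∫ x, f.1 x ∂ν)

/-- The Wasserstein distance `W_1 = d_{Lip 1}`. -/
noncomputable def wassersteinOne {d : ℕ} (μ ν : Measure (Fin d → ℝ)) : ℝ :=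
  ipm {f | LipschitzWith 1 f} μ ν

/-- The weight-penalized discrepancy
`d_{F,lam}(μ, ν) = sup_θ E_μ[φ_θ] - E_ν[φ_θ] - lam * κ(θ)²` with `F = NN(W, L)`, the supremum being
over all weights `θ` of networks of width `W` and depth `L` (no bound on `κ(θ)`). It is finite for
`lam > 0` and probability measures carried by `[0,1]^d`. -/
noncomputable def penalizedIPM {d : ℕ} (W L : ℕ) (lam : ℝ) (μ ν : Measure (Fin d → ℝ)) : ℝ :=
  ⨆ θ : {θ : ReLUNet 1 d L // θ.width = W},
    ((∫ x, θ.1.toFun x ∂μ) - (∫ x, θ.1.toFun x ∂ν) - lam * θ.1.kappa ^ 2)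

/-- The empirical distribution `n⁻¹ ∑ δ_{x_i}` of a sample. -/
noncomputable def empiricalMeasure {d n : ℕ} (x : Fin n → Fin d → ℝ) : Measure (Fin d → ℝ) :=
  (n : ENNReal)⁻¹ • ∑ i, Measure.dirac (x i)

/-! Insert the empirical measure. For `f` in the Hölder class, the error splits into a sampling term
`∫ f dμ - ∫ f dμ̂ₙ` and a training term `∫ f dμ̂ₙ - ∫ f d(ĝ_# ν)`.

Training term. Approximate `f` on the cube by a network `φ_θ` with `κ(θ) ≤ K` and error of order
`K^(-α/(d+1))`, hence of order `n^(-α/d)` (`exists_net_approx`). Let `D > 0` be the discrepancy of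
`φ_θ`. Scaling its output layer by `t` multiplies `D` by `t` and keeps `κ ≤ tK`, so the penalized
supremum is at least `max_t (tD - λt²K²) = D²` when `λ = 1/(4K²)`
(`ReLUNet.integral_sub_le_sqrt_penalizedIPM`). Conversely `κ` bounds the Lipschitz constant, so the
penalized supremum is at most `max_κ (κ W₁ - λκ²) = W₁²/(4λ)`. As the generators reach `W₁ = 0` in
the infimum, the penalized infimum is at most `0` (`iInf_penalizedIPM_nonpos`), the estimator has
objective at most `ε`, and `D ≤ √ε`.

Sampling term (`exists_integrable_deviation_bound`). Telescope the piecewise Taylor polynomials of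
`f` over dyadic scales. At scale `j` there are about `2^(jd)` localized basis functions, with
coefficients of order `2^(-jα)`. The expected sum of the absolute deviations of these basis
functions is of order `2^(jd/2) n^(-1/2)`, since disjoint supports allow Cauchy-Schwarz without
loss. Summing to `2^J ≍ n^(1/d)` gives the rate. The dominating variable does not depend on `f`, so
no supremum over the class has to be measured.

Approximation. A partition of unity of mesh `1/N` glues Taylor polynomials; products become binary
trees of approximate multiplications with `k` knots and error of order `1/k²`. The weight norm is of
order `N^(d+1)`, independently of `k`, and the width is of order `N^d k`. Taking `N ≍ K^(1/(d+1))`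
and `k ≍ N^(α/2)` gives the stated width. -/

/-! ### Taylor expansion in the Hölder class -/

/-- Indices `(m, i)` of the iterated partial derivatives `∂_{i 0} ⋯ ∂_{i (m-1)}`, `m ≤ r`. -/
abbrev TaylorIndex (d r : ℕ) : Type := Σ m : Fin (r + 1), (Fin m.1 → Fin d)

/-- The coefficients of the Taylor polynomial at `z`. -/
noncomputable def taylorCoeff {d r : ℕ} (f : (Fin d → ℝ) → ℝ) (z : Fin d → ℝ)
    (σ : TaylorIndex d r) : ℝ :=
  ((σ.1.1.factorial : ℝ))⁻¹ *
    iteratedFDeriv ℝ σ.1.1 f z (fun j => Pi.single (σ.2 j) (1 : ℝ))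

/-- The Taylor polynomial of order `r` of `f` at `z`, evaluated at `x`. -/
noncomputable def taylorPoly {d : ℕ} (r : ℕ) (f : (Fin d → ℝ) → ℝ) (z x : Fin d → ℝ) : ℝ :=
  ∑ σ : TaylorIndex d r, taylorCoeff f z σ * ∏ j, (x (σ.2 j) - z (σ.2 j))

/-- Expanding in every slot produces all tuples of coordinates, with repetitions. This is why Taylor
polynomials are indexed by tuples with weight `1/m!`, and no multi-index combinatorics is needed. -/
lemma ContinuousMultilinearMap.apply_const_eq_sum {d m : ℕ}
    (M : ContinuousMultilinearMap ℝ (fun _ : Fin m => (Fin d → ℝ)) ℝ) (h : Fin d → ℝ) :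
    M (fun _ => h) =
      ∑ i : Fin m → Fin d, M (fun j => Pi.single (i j) (1 : ℝ)) * ∏ j, h (i j) := by
  have h1 : (fun _ : Fin m => h) =
      fun _ : Fin m => ∑ a : Fin d, h a • (Pi.single a (1 : ℝ) : Fin d → ℝ) := by
    funext _
    exact pi_eq_sum_univ' h
  rw [h1, ContinuousMultilinearMap.map_sum]
  refine Finset.sum_congr rfl fun i _ => ?_
  have := M.map_smul_univ (fun j => h (i j)) (fun j => (Pi.single (i j) (1 : ℝ) : Fin d → ℝ))
  rw [this, smul_eq_mul, mul_comm]

lemma taylorPoly_eq_sum_range {d : ℕ} (r : ℕ) (f : (Fin d → ℝ) → ℝ) (z x : Fin d → ℝ) :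
    taylorPoly r f z x = ∑ m ∈ Finset.range (r + 1),
      ((m.factorial : ℝ))⁻¹ * iteratedFDeriv ℝ m f z (fun _ => x - z) := by
  unfold taylorPoly taylorCoeff
  rw [Fintype.sum_sigma, Finset.sum_range]
  refine Finset.sum_congr rfl fun m _ => ?_
  rw [ContinuousMultilinearMap.apply_const_eq_sum, Finset.mul_sum]
  refine Finset.sum_congr rfl fun i _ => ?_
  simp only [Pi.sub_apply]
  ring

lemma contDiff_comp_line {d r : ℕ} {f : (Fin d → ℝ) → ℝ} (hf : ContDiff ℝ r f)
    (z h : Fin d → ℝ) : ContDiff ℝ r (fun t : ℝ => f (z + t • h)) :=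
  hf.comp (by fun_prop)

lemma iteratedDeriv_comp_line {d r m : ℕ} {f : (Fin d → ℝ) → ℝ} (hf : ContDiff ℝ r f)
    (hm : m ≤ r) (z h : Fin d → ℝ) (t : ℝ) :
    iteratedDeriv m (fun t : ℝ => f (z + t • h)) t =
      iteratedFDeriv ℝ m f (z + t • h) (fun _ => h) := by
  have h1 : (fun t : ℝ => f (z + t • h)) =
      (fun y => f (z + y)) ∘ (ContinuousLinearMap.toSpanSingleton ℝ h) := by
    funext t; simp
  have h2 : ContDiff ℝ r (fun y => f (z + y)) := hf.comp (by fun_prop)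
  rw [iteratedDeriv_eq_iteratedFDeriv, h1,
    ContinuousLinearMap.iteratedFDeriv_comp_right (n := r) _ h2 _
      (by exact_mod_cast hm), ContinuousMultilinearMap.compContinuousLinearMap_apply,
    iteratedFDeriv_comp_add_left]
  simp

section Holder

variable {d r : ℕ} {β : ℝ} {f : (Fin d → ℝ) → ℝ}

lemma abs_le_one_of_mem_holderClass (hf : f ∈ holderClass d r β) (x : Fin d → ℝ) : |f x| ≤ 1 := by
  simpa using hf.2.1 0 (Nat.zero_le _) Fin.elim0 x

lemma continuous_of_mem_holderClass (hf : f ∈ holderClass d r β) : Continuous f :=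
  hf.1.continuous

lemma zero_mem_holderClass : (fun _ => 0) ∈ holderClass d r β := by
  refine ⟨contDiff_const, fun m _ i x => ?_, fun i x y => ?_⟩
  · have : iteratedFDeriv ℝ m (fun _ : Fin d → ℝ => (0 : ℝ)) = 0 := iteratedFDeriv_fun_zero
    simp [this]
  · have : iteratedFDeriv ℝ r (fun _ : Fin d → ℝ => (0 : ℝ)) = 0 := iteratedFDeriv_fun_zero
    simp only [this, Pi.zero_apply, zero_apply, sub_self, abs_zero]
    positivity

lemma abs_taylorCoeff_le_one (hf : f ∈ holderClass d r β) (z : Fin d → ℝ)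
    (σ : TaylorIndex d r) : |taylorCoeff f z σ| ≤ 1 := by
  unfold taylorCoeff
  rw [abs_mul, abs_inv, Nat.abs_cast]
  refine mul_le_one₀ (inv_le_one_of_one_le₀ ?_) (abs_nonneg _)
    (hf.2.1 _ (Nat.lt_succ_iff.1 σ.1.2) _ _)
  exact_mod_cast Nat.one_le_iff_ne_zero.2 (Nat.factorial_ne_zero _)

lemma abs_iteratedFDeriv_sub_le (hf : f ∈ holderClass d r β) (x y h : Fin d → ℝ) :
    |iteratedFDeriv ℝ r f x (fun _ => h) - iteratedFDeriv ℝ r f y (fun _ => h)| ≤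
      (d : ℝ) ^ r * (‖h‖ ^ r * ‖x - y‖ ^ β) := by
  rw [ContinuousMultilinearMap.apply_const_eq_sum, ContinuousMultilinearMap.apply_const_eq_sum,
    ← Finset.sum_sub_distrib]
  refine (Finset.abs_sum_le_sum_abs _ _).trans ?_
  have : ∀ i : Fin r → Fin d,
      |iteratedFDeriv ℝ r f x (fun j => Pi.single (i j) (1 : ℝ)) * ∏ j, h (i j) -
        iteratedFDeriv ℝ r f y (fun j => Pi.single (i j) (1 : ℝ)) * ∏ j, h (i j)| ≤
      ‖h‖ ^ r * ‖x - y‖ ^ β := by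
    intro i
    rw [← sub_mul, abs_mul, mul_comm]
    refine mul_le_mul ?_ (hf.2.2 i x y) (abs_nonneg _) (by positivity)
    rw [Finset.abs_prod]
    calc ∏ j, |h (i j)| ≤ ∏ _j : Fin r, ‖h‖ :=
          Finset.prod_le_prod (fun _ _ => abs_nonneg _) fun j _ => norm_le_pi_norm h (i j)
      _ = ‖h‖ ^ r := by simp
  refine (Finset.sum_le_sum fun i _ => this i).trans ?_
  simp

/-- Taylor's theorem in the Hölder class. -/
theorem abs_sub_taylorPoly_le (hβ : 0 < β) (hf : f ∈ holderClass d r β) (z x : Fin d → ℝ) :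
    |f x - taylorPoly r f z x| ≤ (d : ℝ) ^ r * ‖x - z‖ ^ ((r : ℝ) + β) := by
  -- The Lagrange remainder of order `r`, minus the order `r` Taylor term, is a difference of `r`-th
  -- derivatives, to which the Hölder condition applies.
  have key : ∃ t ∈ Set.Icc (0 : ℝ) 1, f x - taylorPoly r f z x =
      ((r.factorial : ℝ))⁻¹ * (iteratedFDeriv ℝ r f (z + t • (x - z)) (fun _ => x - z) -
        iteratedFDeriv ℝ r f z (fun _ => x - z)) := by
    rw [taylorPoly_eq_sum_range]
    rcases r with _ | s
    · refine ⟨1, by simp, ?_⟩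
      simp
    · have hg := contDiff_comp_line hf.1 z (x - z)
      obtain ⟨t, ht, h⟩ := taylor_mean_remainder_lagrange_iteratedDeriv (zero_ne_one' ℝ)
        (n := s) (f := fun t : ℝ => f (z + t • (x - z))) (by exact_mod_cast hg.contDiffOn)
      rw [Set.uIoo_of_le zero_le_one] at ht
      refine ⟨t, ⟨ht.1.le, ht.2.le⟩, ?_⟩
      rw [iteratedDeriv_comp_line hf.1 le_rfl, taylor_within_apply] at h
      have h2 : ∀ m ∈ Finset.range (s + 1), (((m.factorial : ℝ))⁻¹ * (1 - 0) ^ m) •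
          iteratedDerivWithin m (fun t : ℝ => f (z + t • (x - z))) (Set.uIcc 0 1) 0 =
          ((m.factorial : ℝ))⁻¹ * iteratedFDeriv ℝ m f z (fun _ => x - z) := by
        intro m hm
        have hm' : m ≤ s + 1 := (Finset.mem_range.1 hm).le
        rw [iteratedDerivWithin_eq_iteratedDeriv (uniqueDiffOn_uIcc zero_ne_one)
          ((hg.of_le (by exact_mod_cast hm')).contDiffAt) (by simp),
          iteratedDeriv_comp_line hf.1 hm']
        simp
      rw [Finset.sum_congr rfl h2] at h
      rw [Finset.sum_range_succ]
      simp only [one_smul, add_sub_cancel, sub_zero, one_pow, mul_one] at h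
      linear_combination h
  obtain ⟨t, ht, h⟩ := key
  rw [h, abs_mul, abs_inv, Nat.abs_cast]
  have h1 := abs_iteratedFDeriv_sub_le hf (z + t • (x - z)) z (x - z)
  have h2 : ((r.factorial : ℝ))⁻¹ ≤ 1 := inv_le_one_of_one_le₀ (by
    exact_mod_cast Nat.one_le_iff_ne_zero.2 (Nat.factorial_ne_zero _))
  refine (mul_le_of_le_one_left (abs_nonneg _) h2).trans (h1.trans ?_)
  gcongr
  have h3 : ‖z + t • (x - z) - z‖ ≤ ‖x - z‖ := by
    rw [add_sub_cancel_left, norm_smul, Real.norm_of_nonneg ht.1]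
    exact mul_le_of_le_one_left (norm_nonneg _) ht.2
  calc ‖x - z‖ ^ r * ‖z + t • (x - z) - z‖ ^ β ≤ ‖x - z‖ ^ r * ‖x - z‖ ^ β := by gcongr
    _ = ‖x - z‖ ^ ((r : ℝ) + β) := by
      rw [← Real.rpow_natCast, ← Real.rpow_add_of_nonneg (norm_nonneg _) (by positivity) hβ.le]

end Holder

/-! ### Tensor product interpolation of polynomials -/

/-- The nodes `i / (r + 1)`, `i ≤ r`, of univariate interpolation on `[0,1]`. -/
noncomputable def gridNode (r : ℕ) (i : Fin (r + 1)) : ℝ := (i : ℝ) / (r + 1)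

lemma gridNode_injective (r : ℕ) : Function.Injective (gridNode r) := by
  intro i j h
  have h0 : ((r : ℝ) + 1) ≠ 0 := by positivity
  simp only [gridNode, div_left_inj' h0] at h
  exact Fin.ext (by exact_mod_cast h)

lemma gridNode_mem_Icc (r : ℕ) (i : Fin (r + 1)) : gridNode r i ∈ Set.Icc (0 : ℝ) 1 := by
  have h : (i : ℝ) ≤ r + 1 := by exact_mod_cast i.2.le
  exact ⟨by unfold gridNode; positivity, div_le_one_of_le₀ h (by positivity)⟩

/-- The tensor product Lagrange basis on `[0,1]^d`. -/
noncomputable def tensorLagrange {d r : ℕ} (v : Fin d → Fin (r + 1)) (y : Fin d → ℝ) : ℝ :=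
  ∏ a, (Lagrange.basis Finset.univ (gridNode r) (v a)).eval (y a)

lemma continuous_tensorLagrange {d r : ℕ} (v : Fin d → Fin (r + 1)) :
    Continuous (tensorLagrange v) := by
  unfold tensorLagrange
  fun_prop

lemma exists_abs_tensorLagrange_le (d r : ℕ) : ∃ Λ : ℝ, 0 < Λ ∧
    ∀ (v : Fin d → Fin (r + 1)), ∀ y ∈ Set.Icc (0 : Fin d → ℝ) 1, |tensorLagrange v y| ≤ Λ := by
  have h : ∀ v : Fin d → Fin (r + 1), ∃ B : ℝ, ∀ y ∈ Set.Icc (0 : Fin d → ℝ) 1,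
      ‖tensorLagrange v y‖ ≤ B := fun v =>
    isCompact_Icc.exists_bound_of_continuousOn (continuous_tensorLagrange v).continuousOn
  choose B hB using h
  refine ⟨1 + ∑ v, |B v|, by positivity, fun v y hy => (hB v y hy).trans ?_⟩
  have := Finset.single_le_sum (f := fun v => |B v|) (fun _ _ => abs_nonneg _) (Finset.mem_univ v)
  linarith [le_abs_self (B v)]

lemma Polynomial.eval_eq_sum_gridNode {r : ℕ} {p : Polynomial ℝ} (hp : p.natDegree ≤ r) (t : ℝ) :
    p.eval t = ∑ i : Fin (r + 1), p.eval (gridNode r i) *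
      (Lagrange.basis Finset.univ (gridNode r) i).eval t := by
  have h := Lagrange.eq_interpolate (s := Finset.univ) (v := gridNode r) (f := p)
    (gridNode_injective r).injOn (by
      rw [Finset.card_univ, Fintype.card_fin]
      exact Polynomial.degree_le_natDegree.trans_lt (by exact_mod_cast Nat.lt_succ_of_le hp))
  conv_lhs => rw [h]
  rw [Lagrange.interpolate_apply, Polynomial.eval_finsetSum]
  simp

/-- In each coordinate the factor is a polynomial of degree at most `r`, which `r + 1` nodes
reproduce exactly; multiplying out the univariate interpolations gives the tensor basis. -/
lemma prod_pow_eq_sum_tensorLagrange {d r : ℕ} {s : Fin d → ℕ} (hs : ∀ a, s a ≤ r)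
    (z w y : Fin d → ℝ) (η : ℝ) :
    ∏ a, (w a + η * y a - z a) ^ s a = ∑ v : Fin d → Fin (r + 1),
      (∏ a, (w a + η * gridNode r (v a) - z a) ^ s a) * tensorLagrange v y := by
  have h1 : ∀ a, (w a + η * y a - z a) ^ s a = ∑ i : Fin (r + 1),
      (w a + η * gridNode r i - z a) ^ s a *
        (Lagrange.basis Finset.univ (gridNode r) i).eval (y a) := by
    intro a
    have h2 := Polynomial.eval_eq_sum_gridNode (r := r)
      (p := (Polynomial.C η * Polynomial.X + Polynomial.C (w a - z a)) ^ s a)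
      ((Polynomial.natDegree_pow_le_of_le (s a) Polynomial.natDegree_linear_le).trans
        (by simpa using hs a)) (y a)
    simp only [Polynomial.eval_pow, Polynomial.eval_add, Polynomial.eval_mul, Polynomial.eval_C,
      Polynomial.eval_X] at h2
    calc _ = (η * y a + (w a - z a)) ^ s a := by ring
      _ = _ := h2
      _ = _ := Finset.sum_congr rfl fun i _ => by ring
  simp_rw [h1]
  rw [Finset.prod_univ_sum]
  rw [Fintype.piFinset_univ]
  refine Finset.sum_congr rfl fun v _ => ?_
  rw [Finset.prod_mul_distrib, tensorLagrange]

/-- Interpolation reproduces Taylor polynomials. -/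
lemma taylorPoly_eq_sum_tensorLagrange {d : ℕ} (r : ℕ) (f : (Fin d → ℝ) → ℝ)
    (z w y : Fin d → ℝ) (η : ℝ) :
    taylorPoly r f z (fun a => w a + η * y a) = ∑ v : Fin d → Fin (r + 1),
      taylorPoly r f z (fun a => w a + η * gridNode r (v a)) * tensorLagrange v y := by
  -- Regroup the slots by coordinate: the exponent of coordinate `a` is the number of slots equal to
  -- `a`, which is at most `r`.
  have h1 : ∀ (σ : TaylorIndex d r) (x : Fin d → ℝ),
      ∏ j, (x (σ.2 j) - z (σ.2 j)) =
        ∏ a, (x a - z a) ^ (Finset.univ.filter fun j => σ.2 j = a).card := by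
    intro σ x
    simp_rw [← Finset.prod_const]
    rw [← Finset.prod_fiberwise' Finset.univ σ.2 fun a => (x a - z a)]
  have h2 : ∀ (σ : TaylorIndex d r) (a : Fin d),
      (Finset.univ.filter fun j => σ.2 j = a).card ≤ r := fun σ a =>
    (Finset.card_le_univ _).trans (by simpa using Nat.lt_succ_iff.1 σ.1.2)
  unfold taylorPoly
  simp_rw [Finset.sum_mul]
  rw [Finset.sum_comm]
  refine Finset.sum_congr rfl fun σ _ => ?_
  rw [h1 σ fun a => w a + η * y a, prod_pow_eq_sum_tensorLagrange (h2 σ), Finset.mul_sum]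
  refine Finset.sum_congr rfl fun v _ => ?_
  rw [h1 σ fun a => w a + η * gridNode r (v a), mul_assoc]

/-! ### Dyadic multiscale decomposition -/

/-- The half-open dyadic cube of side `2^{-j}` with lower corner `2^{-j} q`. -/
def dyadicCell {d : ℕ} (j : ℕ) (q : Fin d → ℕ) : Set (Fin d → ℝ) :=
  {x | ∀ a, (q a : ℝ) ≤ 2 ^ j * x a ∧ 2 ^ j * x a < q a + 1}

lemma measurableSet_dyadicCell {d : ℕ} (j : ℕ) (q : Fin d → ℕ) :
    MeasurableSet (dyadicCell j q) := by
  unfold dyadicCell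
  measurability

lemma eq_floor_of_mem_dyadicCell {d : ℕ} {j : ℕ} {q : Fin d → ℕ} {x : Fin d → ℝ}
    (hx : x ∈ dyadicCell j q) : q = fun a => ⌊2 ^ j * x a⌋₊ := by
  funext a
  have h0 : (0 : ℝ) ≤ 2 ^ j * x a := (Nat.cast_nonneg _).trans (hx a).1
  exact ((Nat.floor_eq_iff h0).2 (hx a)).symm

lemma mem_dyadicCell_floor {d : ℕ} (j : ℕ) {x : Fin d → ℝ} (hx : 0 ≤ x) :
    x ∈ dyadicCell j fun a => ⌊2 ^ j * x a⌋₊ := fun a =>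
  ⟨Nat.floor_le (by have := hx a; simp only [Pi.zero_apply] at this; positivity),
    Nat.lt_floor_add_one _⟩

/-- The tensor product Lagrange basis of a dyadic cube, extended by zero. -/
noncomputable def cellBasis {d r : ℕ} (j : ℕ) (q : Fin d → ℕ) (v : Fin d → Fin (r + 1)) :
    (Fin d → ℝ) → ℝ :=
  (dyadicCell j q).indicator fun x => tensorLagrange v fun a => 2 ^ j * x a - q a

lemma measurable_cellBasis {d r : ℕ} (j : ℕ) (q : Fin d → ℕ) (v : Fin d → Fin (r + 1)) :
    Measurable (cellBasis j q v) :=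
  Measurable.indicator ((continuous_tensorLagrange v).comp (by fun_prop)).measurable
    (measurableSet_dyadicCell j q)

lemma abs_cellBasis_le {d r : ℕ} {Λ : ℝ}
    (hΛ : ∀ (v : Fin d → Fin (r + 1)), ∀ y ∈ Set.Icc (0 : Fin d → ℝ) 1, |tensorLagrange v y| ≤ Λ)
    (j : ℕ) (q : Fin d → ℕ) (v : Fin d → Fin (r + 1)) (x : Fin d → ℝ) :
    |cellBasis j q v x| ≤ (dyadicCell j q).indicator (fun _ => Λ) x := by
  unfold cellBasis
  by_cases hx : x ∈ dyadicCell j q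
  · rw [Set.indicator_of_mem hx, Set.indicator_of_mem hx]
    exact hΛ v _ ⟨fun a => by simpa using (hx a).1, fun a => by
      have := (hx a).2
      simp only [Pi.one_apply]
      linarith⟩
  · simp [Set.indicator_of_notMem hx]

/-- Half-open cells are disjoint, so only the cell containing `x` contributes. -/
lemma sum_cellBasis {d r : ℕ} (j : ℕ) {x : Fin d → ℝ} (hx : x ∈ Set.Icc (0 : Fin d → ℝ) 1)
    (c : (Fin d → ℕ) → (Fin d → Fin (r + 1)) → ℝ) :
    ∑ q : Fin d → Fin (2 ^ j + 1), ∑ v,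
      c (fun a => q a) v * cellBasis j (fun a => (q a : ℕ)) v x =
    ∑ v, c (fun a => ⌊2 ^ j * x a⌋₊) v *
      tensorLagrange v fun a => 2 ^ j * x a - (⌊2 ^ j * x a⌋₊ : ℝ) := by
  -- The index range has `2^j + 1` values because `x a = 1` falls into the cell numbered `2^j`.
  have hlt : ∀ a, ⌊(2 : ℝ) ^ j * x a⌋₊ < 2 ^ j + 1 := fun a => by
    rw [Nat.lt_succ_iff]
    refine Nat.floor_le_of_le ?_
    push_cast
    exact mul_le_of_le_one_right (by positivity) (hx.2 a)
  rw [Finset.sum_eq_single (fun a => (⟨⌊2 ^ j * x a⌋₊, hlt a⟩ : Fin (2 ^ j + 1)))]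
  · refine Finset.sum_congr rfl fun v _ => ?_
    simp only [cellBasis]
    rw [Set.indicator_of_mem (mem_dyadicCell_floor j hx.1)]
  · intro q _ hq
    refine Finset.sum_eq_zero fun v _ => ?_
    have : x ∉ dyadicCell j fun a => (q a : ℕ) := fun h => hq (by
      have := eq_floor_of_mem_dyadicCell h
      funext a
      exact Fin.ext (congrFun this a))
    simp [cellBasis, Set.indicator_of_notMem this]
  · simp

/-- The lower corner `2^{-j} q` of a dyadic cube. -/
noncomputable def dyadicCorner {d : ℕ} (j : ℕ) (q : Fin d → ℕ) : Fin d → ℝ :=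
  fun a => (q a : ℝ) / 2 ^ j

/-- The coefficients of the difference of the piecewise Taylor polynomials of two consecutive
dyadic scales in the basis `cellBasis`. -/
noncomputable def cellCoeff {d r : ℕ} (f : (Fin d → ℝ) → ℝ) :
    (j : ℕ) → (Fin d → ℕ) → (Fin d → Fin (r + 1)) → ℝ
  | 0, q, v => taylorPoly r f (dyadicCorner 0 q)
      fun a => dyadicCorner 0 q a + (1 / 2 ^ 0) * gridNode r (v a)
  | j + 1, q, v => taylorPoly r f (dyadicCorner (j + 1) q)
      (fun a => dyadicCorner (j + 1) q a + (1 / 2 ^ (j + 1)) * gridNode r (v a)) -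
      taylorPoly r f (dyadicCorner j fun a => q a / 2)
        fun a => dyadicCorner (j + 1) q a + (1 / 2 ^ (j + 1)) * gridNode r (v a)

lemma eq_dyadicCorner_add {d : ℕ} (j : ℕ) (q : Fin d → ℕ) (x : Fin d → ℝ) :
    x = fun a => dyadicCorner j q a + (1 / 2 ^ j) * (2 ^ j * x a - q a) := by
  funext a
  unfold dyadicCorner
  field_simp
  ring

/-- The scales telescope: the cell of `x` at scale `J` is the parent, with index halved by integer
division, of its cell at scale `J + 1`, so the coarse polynomial subtracted at scale `J + 1` is the
one already accumulated. -/
lemma sum_cellCoeff_mul_cellBasis {d r : ℕ} (f : (Fin d → ℝ) → ℝ) (J : ℕ) {x : Fin d → ℝ}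
    (hx : x ∈ Set.Icc (0 : Fin d → ℝ) 1) :
    ∑ j ∈ Finset.range (J + 1), ∑ q : Fin d → Fin (2 ^ j + 1), ∑ v : Fin d → Fin (r + 1),
      cellCoeff f j (fun a => q a) v * cellBasis j (fun a => (q a : ℕ)) v x =
    taylorPoly r f (dyadicCorner J fun a => ⌊2 ^ J * x a⌋₊) x := by
  have repr : ∀ (j : ℕ) (q : Fin d → ℕ) (z : Fin d → ℝ), taylorPoly r f z x =
      ∑ v : Fin d → Fin (r + 1),
        taylorPoly r f z (fun a => dyadicCorner j q a + (1 / 2 ^ j) * gridNode r (v a)) *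
          tensorLagrange v fun a => 2 ^ j * x a - q a := by
    intro j q z
    conv_lhs => rw [eq_dyadicCorner_add j q x]
    rw [taylorPoly_eq_sum_tensorLagrange]
  induction J with
  | zero =>
    rw [zero_add, Finset.sum_range_one, sum_cellBasis 0 hx (cellCoeff f 0), repr 0]
    rfl
  | succ J ih =>
    rw [Finset.sum_range_succ, ih, sum_cellBasis (J + 1) hx (cellCoeff f (J + 1))]
    have hpar : (fun a => ⌊2 ^ J * x a⌋₊) = fun a => ⌊(2 : ℝ) ^ (J + 1) * x a⌋₊ / 2 := by
      funext a
      have := Nat.floor_div_natCast ((2 : ℝ) ^ (J + 1) * x a) 2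
      rw [← this]
      congr 1
      push_cast
      ring
    rw [hpar]
    simp only [cellCoeff, sub_mul, Finset.sum_sub_distrib]
    rw [← repr (J + 1) (fun a => ⌊2 ^ (J + 1) * x a⌋₊),
      ← repr (J + 1) (fun a => ⌊2 ^ (J + 1) * x a⌋₊)]
    ring

lemma norm_dyadicCorner_add_sub_le {d r : ℕ} (j : ℕ) (q : Fin d → ℕ) (v : Fin d → Fin (r + 1)) :
    ‖(fun a => dyadicCorner j q a + (1 / 2 ^ j) * gridNode r (v a)) - dyadicCorner j q‖ ≤
      1 / 2 ^ j := by
  refine (pi_norm_le_iff_of_nonneg (by positivity)).2 fun a => ?_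
  have h := gridNode_mem_Icc r (v a)
  rw [Pi.sub_apply, add_sub_cancel_left, Real.norm_of_nonneg (mul_nonneg (by positivity) h.1)]
  exact mul_le_of_le_one_right (by positivity) h.2

lemma norm_dyadicCorner_add_sub_parent_le {d r : ℕ} (j : ℕ) (q : Fin d → ℕ)
    (v : Fin d → Fin (r + 1)) :
    ‖(fun a => dyadicCorner (j + 1) q a + (1 / 2 ^ (j + 1)) * gridNode r (v a)) -
      dyadicCorner j fun a => q a / 2‖ ≤ 2 * (1 / 2 ^ (j + 1)) := by
  refine (pi_norm_le_iff_of_nonneg (by positivity)).2 fun a => ?_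
  have h := gridNode_mem_Icc r (v a)
  have h2 : (q a : ℝ) = 2 * ((q a / 2 : ℕ) : ℝ) + ((q a % 2 : ℕ) : ℝ) := by
    exact_mod_cast (Nat.div_add_mod (q a) 2).symm
  have h3 : ((q a % 2 : ℕ) : ℝ) ≤ 1 := by
    exact_mod_cast Nat.lt_succ_iff.1 (Nat.mod_lt (q a) two_pos)
  have h4 : (0 : ℝ) ≤ ((q a % 2 : ℕ) : ℝ) := Nat.cast_nonneg _
  have h5 : dyadicCorner (j + 1) q a + 1 / 2 ^ (j + 1) * gridNode r (v a) -
      dyadicCorner j (fun a => q a / 2) a =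
      (((q a % 2 : ℕ) : ℝ) + gridNode r (v a)) * (1 / 2 ^ (j + 1)) := by
    unfold dyadicCorner
    rw [h2]
    field_simp
    ring
  rw [Pi.sub_apply, h5, Real.norm_of_nonneg (mul_nonneg (add_nonneg h4 h.1) (by positivity))]
  gcongr
  linarith [h.2]

/-- At an interpolation node both Taylor polynomials are close to `f`: the node is within `2^(-j)`
of the corner of its cell and within `2 · 2^(-j)` of the corner of the parent. The summand `1` in
the constant covers scale `0`, where `|f| ≤ 1` is used instead. -/
lemma abs_cellCoeff_le {d r : ℕ} {β : ℝ} (hβ : 0 < β) {f : (Fin d → ℝ) → ℝ}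
    (hf : f ∈ holderClass d r β) (j : ℕ) (q : Fin d → ℕ) (v : Fin d → Fin (r + 1)) :
    |cellCoeff f j q v| ≤
      (1 + (d : ℝ) ^ r * (1 + 2 ^ ((r : ℝ) + β))) * (1 / 2 ^ j) ^ ((r : ℝ) + β) := by
  have hα : (0 : ℝ) < (r : ℝ) + β := by positivity
  have h1 : ∀ j, |f (fun a => dyadicCorner j q a + (1 / 2 ^ j) * gridNode r (v a)) -
      taylorPoly r f (dyadicCorner j q)
        (fun a => dyadicCorner j q a + (1 / 2 ^ j) * gridNode r (v a))| ≤
      (d : ℝ) ^ r * (1 / 2 ^ j) ^ ((r : ℝ) + β) := fun j => by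
    refine (abs_sub_taylorPoly_le hβ hf _ _).trans ?_
    gcongr
    exact norm_dyadicCorner_add_sub_le j q v
  rcases j with _ | j
  · have h2 := abs_le.1 (h1 0)
    have h3 := abs_le.1 (abs_le_one_of_mem_holderClass hf
      (fun a => dyadicCorner 0 q a + (1 / 2 ^ 0) * gridNode r (v a)))
    have h4 : (0 : ℝ) ≤ (d : ℝ) ^ r * 2 ^ ((r : ℝ) + β) := by positivity
    have h5 : (1 / 2 ^ 0 : ℝ) ^ ((r : ℝ) + β) = 1 := by simp
    rw [h5] at h2 ⊢
    rw [cellCoeff, abs_le]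
    constructor <;> linarith [h2.1, h2.2, h3.1, h3.2]
  · have h2 := abs_le.1 (h1 (j + 1))
    have h3 : |f (fun a => dyadicCorner (j + 1) q a + (1 / 2 ^ (j + 1)) * gridNode r (v a)) -
        taylorPoly r f (dyadicCorner j fun a => q a / 2)
          (fun a => dyadicCorner (j + 1) q a + (1 / 2 ^ (j + 1)) * gridNode r (v a))| ≤
        (d : ℝ) ^ r * (2 ^ ((r : ℝ) + β) * (1 / 2 ^ (j + 1)) ^ ((r : ℝ) + β)) := by
      refine (abs_sub_taylorPoly_le hβ hf _ _).trans ?_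
      rw [← Real.mul_rpow zero_le_two (by positivity)]
      gcongr
      exact norm_dyadicCorner_add_sub_parent_le j q v
    have h3 := abs_le.1 h3
    have h4 : (0 : ℝ) ≤ (1 / 2 ^ (j + 1)) ^ ((r : ℝ) + β) := by positivity
    rw [cellCoeff, abs_le]
    constructor <;> nlinarith [h2.1, h2.2, h3.1, h3.2]

lemma abs_sub_sum_cellBasis_le {d r : ℕ} {β : ℝ} (hβ : 0 < β) {f : (Fin d → ℝ) → ℝ}
    (hf : f ∈ holderClass d r β) (J : ℕ) {x : Fin d → ℝ}
    (hx : x ∈ Set.Icc (0 : Fin d → ℝ) 1) :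
    |f x - ∑ j ∈ Finset.range (J + 1), ∑ q : Fin d → Fin (2 ^ j + 1),
      ∑ v : Fin d → Fin (r + 1),
        cellCoeff f j (fun a => q a) v * cellBasis j (fun a => (q a : ℕ)) v x| ≤
      (d : ℝ) ^ r * (1 / 2 ^ J) ^ ((r : ℝ) + β) := by
  have hα : (0 : ℝ) < (r : ℝ) + β := by positivity
  rw [sum_cellCoeff_mul_cellBasis f J hx]
  refine (abs_sub_taylorPoly_le hβ hf _ _).trans ?_
  gcongr
  refine (pi_norm_le_iff_of_nonneg (by positivity)).2 fun a => ?_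
  have h := mem_dyadicCell_floor J hx.1 a
  have h2 : x a - (⌊2 ^ J * x a⌋₊ : ℝ) / 2 ^ J = (2 ^ J * x a - ⌊2 ^ J * x a⌋₊) * (1 / 2 ^ J) := by
    field_simp
  rw [Pi.sub_apply, dyadicCorner, h2,
    Real.norm_of_nonneg (mul_nonneg (by linarith [h.1]) (by positivity))]
  exact mul_le_of_le_one_left (by positivity) (by linarith [h.2])

/-! ### Summation over scales and the resulting rate -/

section Rate

lemma natLog_div_bounds {d n : ℕ} (hd : 1 ≤ d) (hn : 1 ≤ n) :
    ((2 : ℝ) ^ (Nat.log 2 n / d)) ≤ (n : ℝ) ^ (1 / d : ℝ) ∧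
      (n : ℝ) ^ (1 / d : ℝ) ≤ 2 * 2 ^ (Nat.log 2 n / d) := by
  have hd0 : (d : ℝ) ≠ 0 := by positivity
  have hroot : ∀ k : ℕ, (((2 : ℝ) ^ (k * d)) ^ (1 / d : ℝ)) = 2 ^ k := fun k => by
    rw [pow_mul, ← Real.rpow_natCast (2 ^ k) d, ← Real.rpow_mul (by positivity),
      mul_one_div_cancel hd0, Real.rpow_one]
  constructor
  · rw [← hroot]
    refine Real.rpow_le_rpow (by positivity) ?_ (by positivity)
    have : 2 ^ (Nat.log 2 n / d * d) ≤ n :=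
      (Nat.pow_le_pow_right two_pos (Nat.div_mul_le_self _ _)).trans
        (Nat.pow_log_le_self 2 (by omega))
    exact_mod_cast this
  · rw [← pow_succ', ← hroot]
    refine Real.rpow_le_rpow (by positivity) ?_ (by positivity)
    have : n ≤ 2 ^ ((Nat.log 2 n / d + 1) * d) := by
      refine (Nat.lt_pow_succ_log_self one_lt_two n).le.trans (Nat.pow_le_pow_right two_pos ?_)
      have := Nat.lt_div_mul_add (a := Nat.log 2 n) (b := d) (by omega)
      rw [add_mul]
      omega
    exact_mod_cast this

/-- The rate of convergence of the empirical measure. -/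
noncomputable def empiricalRate (d : ℕ) (α : ℝ) (n : ℕ) : ℝ :=
  max ((n : ℝ) ^ (-(α / d)))
    ((n : ℝ) ^ (-(1 / 2 : ℝ)) * Real.log n ^ (if 2 * α = d then (1 : ℕ) else 0))

lemma rpow_le_empiricalRate (d : ℕ) (α : ℝ) (n : ℕ) :
    (n : ℝ) ^ (-(α / d)) ≤ empiricalRate d α n := le_max_left _ _

/-- With `J = ⌊log₂ n⌋ / d` one has `2^J ≍ n^(1/d)`, and the sum is geometric with ratio `q = 2^(d/2
- α)`. It is bounded if `q < 1`, equals `J + 1` if `q = 1` (the source of the logarithm), and is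
comparable to its last term if `q > 1`. -/
lemma exists_scale_sum_le {d : ℕ} (hd : 1 ≤ d) {α : ℝ} (hα : 0 < α) : ∃ C : ℝ, 0 < C ∧
    ∀ n : ℕ, 1 ≤ n → ∃ J : ℕ,
      (n : ℝ) ^ (-(1 / 2 : ℝ)) *
        ∑ j ∈ Finset.range (J + 1), ((1 / 2 ^ j : ℝ) ^ α * ((2 : ℝ) ^ j) ^ ((d : ℝ) / 2)) ≤
        C * empiricalRate d α n ∧
      (1 / 2 ^ J : ℝ) ^ α ≤ C * empiricalRate d α n := by
  have hd0 : (0 : ℝ) < d := by positivity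
  set q : ℝ := 2 ^ ((d : ℝ) / 2 - α) with hq
  have hq0 : 0 < q := by positivity
  have hterm : ∀ j : ℕ, ((1 / 2 ^ j : ℝ) ^ α * ((2 : ℝ) ^ j) ^ ((d : ℝ) / 2)) = q ^ j := fun j => by
    rw [one_div, Real.inv_rpow (by positivity), ← Real.rpow_neg (by positivity),
      ← Real.rpow_add (by positivity), hq, ← Real.rpow_natCast 2 j, ← Real.rpow_natCast,
      ← Real.rpow_mul zero_le_two, ← Real.rpow_mul zero_le_two]
    ring_nf
  have hlast : ∀ n : ℕ, 1 ≤ n →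
      (1 / 2 ^ (Nat.log 2 n / d) : ℝ) ^ α ≤ 2 ^ α * empiricalRate d α n := fun n hn => by
    have hn0 : (0 : ℝ) < n := by exact_mod_cast hn
    have h := (natLog_div_bounds hd hn).2
    calc (1 / 2 ^ (Nat.log 2 n / d) : ℝ) ^ α ≤ (2 * (n : ℝ) ^ (-(1 / d : ℝ))) ^ α := by
          refine Real.rpow_le_rpow (by positivity) ?_ hα.le
          rw [Real.rpow_neg hn0.le, ← div_eq_mul_inv, div_le_div_iff₀ (by positivity)
            (by positivity)]
          linarith
      _ = 2 ^ α * (n : ℝ) ^ (-(α / d)) := by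
          rw [Real.mul_rpow zero_le_two (by positivity), ← Real.rpow_mul hn0.le]
          congr 2
          ring
      _ ≤ _ := by
          gcongr
          exact rpow_le_empiricalRate d α n
  suffices h : ∃ C : ℝ, 0 < C ∧ ∀ n : ℕ, 1 ≤ n → (n : ℝ) ^ (-(1 / 2 : ℝ)) *
      ∑ j ∈ Finset.range (Nat.log 2 n / d + 1), q ^ j ≤ C * empiricalRate d α n by
    obtain ⟨C, hC, h⟩ := h
    refine ⟨C + 2 ^ α, by positivity, fun n hn => ⟨Nat.log 2 n / d, ?_, ?_⟩⟩
    · simp_rw [hterm]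
      refine (h n hn).trans ?_
      have : 0 ≤ empiricalRate d α n :=
        le_trans (by positivity) (rpow_le_empiricalRate d α n)
      gcongr
      exact le_add_of_nonneg_right (by positivity)
    · refine (hlast n hn).trans ?_
      have : 0 ≤ empiricalRate d α n :=
        le_trans (by positivity) (rpow_le_empiricalRate d α n)
      gcongr
      exact le_add_of_nonneg_left hC.le
  rcases lt_trichotomy ((d : ℝ) / 2) α with hlt | heq | hgt
  · have hq1 : q < 1 := Real.rpow_lt_one_of_one_lt_of_neg one_lt_two (by linarith)
    refine ⟨(1 - q)⁻¹, inv_pos.2 (by linarith), fun n hn => ?_⟩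
    have h1 : ∑ j ∈ Finset.range (Nat.log 2 n / d + 1), q ^ j ≤ (1 - q)⁻¹ := by
      rw [← tsum_geometric_of_lt_one hq0.le hq1]
      exact Summable.sum_le_tsum _ (fun _ _ => by positivity)
        (summable_geometric_of_lt_one hq0.le hq1)
    have h2 : (n : ℝ) ^ (-(1 / 2 : ℝ)) ≤ empiricalRate d α n := by
      have : ¬ 2 * α = d := by
        intro h
        linarith
      simp [empiricalRate, this]
    rw [mul_comm]
    have : 0 ≤ (1 - q)⁻¹ := inv_nonneg.2 (by linarith)
    gcongr
  · have hq1 : q = 1 := by rw [hq, heq, sub_self, Real.rpow_zero]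
    -- The sum is `J + 1` with `J ≤ 2 log n`, since `log 2 ≥ 1/2`. The `1` is absorbed by `n^(-α/d)
    -- = n^(-1/2)`, which also covers `n = 1`, where the logarithm vanishes.
    refine ⟨3, by norm_num, fun n hn => ?_⟩
    have hn1 : (1 : ℝ) ≤ n := by exact_mod_cast hn
    have h2α : 2 * α = d := by linarith
    have h1 : (n : ℝ) ^ (-(1 / 2 : ℝ)) ≤ empiricalRate d α n := by
      have := rpow_le_empiricalRate d α n
      have e : α / d = 1 / 2 := by
        rw [← heq]
        field_simp
      rwa [e] at this
    have h2 : (n : ℝ) ^ (-(1 / 2 : ℝ)) * Real.log n ≤ empiricalRate d α n := by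
      refine le_trans (le_of_eq ?_) (le_max_right _ _)
      rw [if_pos h2α, pow_one]
    have hlog : ((Nat.log 2 n / d : ℕ) : ℝ) ≤ 2 * Real.log n := by
      have h3 : (2 : ℝ) ^ (Nat.log 2 n / d) ≤ n := by
        have : 2 ^ (Nat.log 2 n / d) ≤ n :=
          (Nat.pow_le_pow_right two_pos (Nat.div_le_self _ _)).trans
            (Nat.pow_log_le_self 2 (by omega))
        exact_mod_cast this
      have h4 := Real.log_le_log (by positivity) h3
      rw [Real.log_pow] at h4
      have h5 := Real.log_two_gt_d9
      have h6 : (0 : ℝ) ≤ ((Nat.log 2 n / d : ℕ) : ℝ) := Nat.cast_nonneg _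
      nlinarith
    have h7 : ∑ j ∈ Finset.range (Nat.log 2 n / d + 1), q ^ j =
        ((Nat.log 2 n / d : ℕ) : ℝ) + 1 := by
      simp [hq1]
    rw [h7]
    have h8 : (0 : ℝ) ≤ (n : ℝ) ^ (-(1 / 2 : ℝ)) := by positivity
    nlinarith [mul_le_mul_of_nonneg_left hlog h8]
  · have hq1 : 1 < q := Real.one_lt_rpow one_lt_two (by linarith)
    refine ⟨q / (q - 1), div_pos hq0 (by linarith), fun n hn => ?_⟩
    have hn0 : (0 : ℝ) < n := by exact_mod_cast hn
    have h1 : ∑ j ∈ Finset.range (Nat.log 2 n / d + 1), q ^ j ≤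
        q / (q - 1) * q ^ (Nat.log 2 n / d) := by
      rw [geom_sum_eq hq1.ne', div_mul_eq_mul_div, ← pow_succ']
      gcongr
      all_goals linarith
    have h2 : q ^ (Nat.log 2 n / d) ≤ (n : ℝ) ^ (1 / 2 - α / d) := by
      have h3 := (natLog_div_bounds hd hn).1
      calc q ^ (Nat.log 2 n / d) = ((2 : ℝ) ^ (Nat.log 2 n / d)) ^ ((d : ℝ) / 2 - α) := by
            rw [hq, ← Real.rpow_natCast, ← Real.rpow_mul zero_le_two, mul_comm,
              Real.rpow_mul zero_le_two, Real.rpow_natCast]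
        _ ≤ ((n : ℝ) ^ (1 / d : ℝ)) ^ ((d : ℝ) / 2 - α) :=
            Real.rpow_le_rpow (by positivity) h3 (by linarith)
        _ = _ := by
            rw [← Real.rpow_mul hn0.le]
            congr 1
            field_simp
    have h4 : 0 ≤ q / (q - 1) := div_nonneg hq0.le (by linarith)
    calc (n : ℝ) ^ (-(1 / 2 : ℝ)) * ∑ j ∈ Finset.range (Nat.log 2 n / d + 1), q ^ j
        ≤ (n : ℝ) ^ (-(1 / 2 : ℝ)) * (q / (q - 1) * (n : ℝ) ^ (1 / 2 - α / d)) := by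
          gcongr
          exact h1.trans (by gcongr)
      _ = q / (q - 1) * (n : ℝ) ^ (-(α / d)) := by
          rw [mul_left_comm, ← Real.rpow_add hn0]
          congr 2
          ring
      _ ≤ _ := by
          gcongr
          exact rpow_le_empiricalRate d α n

end Rate

/-! ### Fluctuations of empirical means -/

section Empirical

variable {d n : ℕ} {μ : Measure (Fin d → ℝ)} {Ω : Type*} {X : Fin n → Ω → (Fin d → ℝ)}

/-- The deviation of the empirical mean of `h` from its expectation. -/
noncomputable def deviation (μ : Measure (Fin d → ℝ)) (X : Fin n → Ω → (Fin d → ℝ))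
    (h : (Fin d → ℝ) → ℝ) (ω : Ω) : ℝ :=
  (∫ x, h x ∂μ) - (n : ℝ)⁻¹ * ∑ i, h (X i ω)

lemma abs_deviation_le [IsProbabilityMeasure μ] (hn : 1 ≤ n) {h : (Fin d → ℝ) → ℝ} {B : ℝ}
    (hB : ∀ x, |h x| ≤ B) (ω : Ω) : |deviation μ X h ω| ≤ 2 * B := by
  have hn0 : (0 : ℝ) < n := by exact_mod_cast hn
  have h1 : |∫ x, h x ∂μ| ≤ B := by
    simpa using norm_integral_le_of_norm_le_const (μ := μ) (f := h) (.of_forall hB)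
  have h2 : |(n : ℝ)⁻¹ * ∑ i, h (X i ω)| ≤ B := by
    rw [abs_mul, abs_inv, Nat.abs_cast, inv_mul_le_iff₀ hn0]
    refine (Finset.abs_sum_le_sum_abs _ _).trans ((Finset.sum_le_sum fun i _ => hB _).trans ?_)
    simp
  exact (abs_sub _ _).trans (by linarith)

variable [MeasurableSpace Ω] {P : Measure Ω}

lemma aemeasurable_deviation (hX : ∀ i, HasLaw (X i) μ P) {h : (Fin d → ℝ) → ℝ}
    (hh : Measurable h) : AEMeasurable (deviation μ X h) P := by
  unfold deviation
  have : ∀ i, AEMeasurable (fun ω => h (X i ω)) P := fun i =>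
    hh.comp_aemeasurable (hX i).aemeasurable
  have := Finset.aemeasurable_fun_sum (Finset.univ : Finset (Fin n)) fun i _ => this i
  fun_prop

variable [IsProbabilityMeasure P]

lemma memLp_deviation [IsProbabilityMeasure μ] (hn : 1 ≤ n) (hX : ∀ i, HasLaw (X i) μ P) {h : (Fin d → ℝ) → ℝ}
    (hh : Measurable h) {B : ℝ} (hB : ∀ x, |h x| ≤ B) : MemLp (deviation μ X h) 2 P :=
  MemLp.of_bound (aemeasurable_deviation hX hh).aestronglyMeasurable (2 * B)
    (.of_forall fun ω => abs_deviation_le hn hB ω)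

/-- The left side is the variance of the empirical mean. Independence makes variances add, and each
is at most a second moment. -/
lemma integral_sq_deviation_le (hn : 1 ≤ n) (hX : ∀ i, HasLaw (X i) μ P) (hi : iIndepFun X P)
    {h : (Fin d → ℝ) → ℝ} (hh : Measurable h) {B : ℝ} (hB : ∀ x, |h x| ≤ B) :
    ∫ ω, deviation μ X h ω ^ 2 ∂P ≤ (n : ℝ)⁻¹ * ∫ x, h x ^ 2 ∂μ := by
  have hn0 : (n : ℝ) ≠ 0 := by positivity
  have hY : ∀ i, MemLp (h ∘ X i) 2 P := fun i =>
    MemLp.of_bound (hh.comp_aemeasurable (hX i).aemeasurable).aestronglyMeasurable B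
      (.of_forall fun ω => hB _)
  have hEY : ∀ i, ∫ ω, (h ∘ X i) ω ∂P = ∫ x, h x ∂μ := fun i =>
    (hX i).integral_comp hh.aestronglyMeasurable
  set S : Ω → ℝ := (n : ℝ)⁻¹ • ∑ i, h ∘ X i with hS
  have hS2 : ∀ ω, S ω = (n : ℝ)⁻¹ * ∑ i, h (X i ω) := fun ω => by simp [hS]
  have hSm : MemLp S 2 P := (memLp_finsetSum' _ fun i _ => hY i).const_smul _
  have hES : ∫ ω, S ω ∂P = ∫ x, h x ∂μ := by
    simp_rw [hS2]
    have h1 : ∀ i, ∫ ω, h (X i ω) ∂P = ∫ x, h x ∂μ := hEY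
    have h2 : ∀ i, Integrable (fun ω => h (X i ω)) P := fun i => (hY i).integrable one_le_two
    rw [integral_const_mul, integral_finsetSum _ fun i _ => h2 i]
    simp [h1, hn0]
  have hvar : Var[S; P] = ∫ ω, deviation μ X h ω ^ 2 ∂P := by
    rw [variance_eq_integral hSm.aemeasurable, hES]
    refine integral_congr_ae (.of_forall fun ω => ?_)
    simp only [deviation, hS2]
    ring
  rw [← hvar, hS, variance_smul, IndepFun.variance_sum (fun i _ => hY i)
    fun i _ j _ hij => (hi.indepFun hij).comp hh hh]
  have h1 : ∀ i, Var[h ∘ X i; P] ≤ ∫ x, h x ^ 2 ∂μ := fun i => by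
    refine (variance_le_expectation_sq (hY i).aestronglyMeasurable).trans (le_of_eq ?_)
    exact (hX i).integral_comp (f := fun x => h x ^ 2) (hh.pow_const 2).aestronglyMeasurable
  calc ((n : ℝ)⁻¹) ^ 2 * ∑ i, Var[h ∘ X i; P]
      ≤ ((n : ℝ)⁻¹) ^ 2 * ∑ _i : Fin n, ∫ x, h x ^ 2 ∂μ := by
        gcongr with i
        exact h1 i
    _ = (n : ℝ)⁻¹ * ∫ x, h x ^ 2 ∂μ := by
        simp
        field_simp

/-- Jensen, then Cauchy-Schwarz over the index set. Because `∑ h_t²` is bounded pointwise, the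
second moments add up to at most `B²`, so the cost is `√card` and not `card`. -/
lemma integral_sum_abs_deviation_le [IsProbabilityMeasure μ] (hn : 1 ≤ n) (hX : ∀ i, HasLaw (X i) μ P)
    (hi : iIndepFun X P) {T : Type*} [Fintype T] {h : T → (Fin d → ℝ) → ℝ}
    (hh : ∀ t, Measurable (h t)) {B : ℝ} (hB0 : 0 ≤ B) (hB : ∀ x, ∑ t, h t x ^ 2 ≤ B ^ 2) :
    ∫ ω, ∑ t, |deviation μ X (h t) ω| ∂P ≤
      √(Fintype.card T) * B * (n : ℝ) ^ (-(1 / 2 : ℝ)) := by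
  have hn0 : (0 : ℝ) < n := by exact_mod_cast hn
  have hb : ∀ t x, |h t x| ≤ B := fun t x => by
    refine abs_le_of_sq_le_sq ?_ hB0
    exact (Finset.single_le_sum (f := fun t => h t x ^ 2) (fun _ _ => sq_nonneg _)
      (Finset.mem_univ t)).trans (hB x)
  have hm : ∀ t, MemLp (deviation μ X (h t)) 2 P := fun t => memLp_deviation hn hX (hh t) (hb t)
  set Z : Ω → ℝ := fun ω => ∑ t, |deviation μ X (h t) ω| with hZ
  have hZm : MemLp Z 2 P := memLp_finsetSum _ fun t _ => (hm t).abs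
  -- Jensen's inequality, as nonnegativity of the variance.
  have h1 : (∫ ω, Z ω ∂P) ^ 2 ≤ ∫ ω, Z ω ^ 2 ∂P := by
    have h2 := variance_nonneg Z P
    rw [variance_eq_sub hZm] at h2
    simp only [Pi.pow_apply] at h2
    linarith
  have h2 : ∫ ω, Z ω ^ 2 ∂P ≤ Fintype.card T * ((n : ℝ)⁻¹ * B ^ 2) := by
    calc ∫ ω, Z ω ^ 2 ∂P ≤ ∫ ω, (Fintype.card T : ℝ) * ∑ t, deviation μ X (h t) ω ^ 2 ∂P := by
          refine integral_mono hZm.integrable_sq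
            ((integrable_finsetSum _ fun t _ => (hm t).integrable_sq).const_mul _) fun ω => ?_
          have := sq_sum_le_card_mul_sum_sq (s := (Finset.univ : Finset T))
            (f := fun t => |deviation μ X (h t) ω|)
          simpa [hZ] using this
      _ = (Fintype.card T : ℝ) * ∑ t, ∫ ω, deviation μ X (h t) ω ^ 2 ∂P := by
          rw [integral_const_mul, integral_finsetSum _ fun t _ => (hm t).integrable_sq]
      _ ≤ (Fintype.card T : ℝ) * ∑ t, (n : ℝ)⁻¹ * ∫ x, h t x ^ 2 ∂μ := by
          gcongr with t
          exact integral_sq_deviation_le hn hX hi (hh t) (hb t)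
      _ = (Fintype.card T : ℝ) * ((n : ℝ)⁻¹ * ∫ x, ∑ t, h t x ^ 2 ∂μ) := by
          have hint : ∀ t, Integrable (fun x => h t x ^ 2) μ := fun t =>
            Integrable.of_bound ((hh t).pow_const 2).aestronglyMeasurable (B ^ 2)
              (.of_forall fun x => by
                rw [Real.norm_of_nonneg (sq_nonneg _), ← sq_abs]
                exact pow_le_pow_left₀ (abs_nonneg _) (hb t x) 2)
          rw [integral_finsetSum _ fun t _ => hint t, Finset.mul_sum, Finset.mul_sum,
            Finset.mul_sum]
      _ ≤ (Fintype.card T : ℝ) * ((n : ℝ)⁻¹ * B ^ 2) := by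
          gcongr
          refine (integral_mono_of_nonneg (.of_forall fun x =>
            Finset.sum_nonneg fun t _ => sq_nonneg _) (integrable_const (B ^ 2))
            (.of_forall hB)).trans (le_of_eq (by simp))
  refine (le_abs_self _).trans (abs_le_of_sq_le_sq ?_ (by positivity))
  refine (h1.trans h2).trans (le_of_eq ?_)
  rw [mul_pow, mul_pow, Real.sq_sqrt (Nat.cast_nonneg _), ← Real.rpow_natCast (_ ^ _) 2,
    ← Real.rpow_mul hn0.le]
  norm_num
  rw [Real.rpow_neg_one]
  ring

end Empirical

lemma integral_empiricalMeasure {d n : ℕ} (x : Fin n → Fin d → ℝ) (f : (Fin d → ℝ) → ℝ) :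
    ∫ y, f y ∂empiricalMeasure x = (n : ℝ)⁻¹ * ∑ i, f (x i) := by
  unfold empiricalMeasure
  rw [integral_smul_measure, integral_finsetSum_measure fun i _ => integrable_dirac (by simp)]
  simp

lemma isProbabilityMeasure_empiricalMeasure {d n : ℕ} (hn : 1 ≤ n) (x : Fin n → Fin d → ℝ) :
    IsProbabilityMeasure (empiricalMeasure x) := by
  refine ⟨?_⟩
  have : (n : ENNReal) ≠ 0 := by
    simp only [ne_eq, Nat.cast_eq_zero]
    omega
  simp [empiricalMeasure, ENNReal.inv_mul_cancel this (ENNReal.natCast_ne_top n)]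

section Deviation

variable {d n : ℕ} {μ : Measure (Fin d → ℝ)} {Ω : Type*} {X : Fin n → Ω → (Fin d → ℝ)}

lemma deviation_sum {T : Type*} (s : Finset T) {h : T → (Fin d → ℝ) → ℝ}
    (hh : ∀ t ∈ s, Integrable (h t) μ) (ω : Ω) :
    deviation μ X (fun x => ∑ t ∈ s, h t x) ω = ∑ t ∈ s, deviation μ X (h t) ω := by
  simp only [deviation, Finset.sum_sub_distrib, integral_finsetSum _ hh, ← Finset.mul_sum]
  rw [Finset.sum_comm]

lemma deviation_const_mul (c : ℝ) (h : (Fin d → ℝ) → ℝ) (ω : Ω) :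
    deviation μ X (fun x => c * h x) ω = c * deviation μ X h ω := by
  simp only [deviation, integral_const_mul, ← Finset.mul_sum]
  ring

lemma deviation_le_add [IsProbabilityMeasure μ] (hn : 1 ≤ n) {s : Set (Fin d → ℝ)}
    (hμ : ∀ᵐ x ∂μ, x ∈ s) {ω : Ω} (hω : ∀ i, X i ω ∈ s) {f g : (Fin d → ℝ) → ℝ} {ρ : ℝ}
    (hf : Integrable f μ) (hg : Integrable g μ) (hfg : ∀ x ∈ s, |f x - g x| ≤ ρ) :
    deviation μ X f ω ≤ deviation μ X g ω + 2 * ρ := by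
  have hn0 : (0 : ℝ) < n := by exact_mod_cast hn
  have h1 : ∫ x, f x ∂μ ≤ (∫ x, g x ∂μ) + ρ := by
    have : ∫ x, f x ∂μ ≤ ∫ x, (g x + ρ) ∂μ := by
      refine integral_mono_ae hf (hg.add (integrable_const _)) ?_
      filter_upwards [hμ] with x hx
      linarith [(abs_le.1 (hfg x hx)).2]
    rwa [integral_add hg (integrable_const _), integral_const, probReal_univ, one_smul] at this
  have h2 : (n : ℝ)⁻¹ * ∑ i, g (X i ω) ≤ (n : ℝ)⁻¹ * ∑ i, f (X i ω) + ρ := by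
    have : ∑ i, g (X i ω) ≤ ∑ i, f (X i ω) + n * ρ := by
      calc ∑ i, g (X i ω) ≤ ∑ i, (f (X i ω) + ρ) :=
            Finset.sum_le_sum fun i _ => by linarith [(abs_le.1 (hfg _ (hω i))).1]
        _ = _ := by simp [Finset.sum_add_distrib]
    calc _ ≤ (n : ℝ)⁻¹ * (∑ i, f (X i ω) + n * ρ) := by gcongr
      _ = _ := by field_simp
  unfold deviation
  linarith

end Deviation

/-- At each point at most one cell is active, with `(r + 1)^d` basis functions; hence the bound does
not grow with `j`. -/
lemma sum_sq_cellBasis_le {d r : ℕ} {Λ : ℝ}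
    (hΛ : ∀ (v : Fin d → Fin (r + 1)), ∀ y ∈ Set.Icc (0 : Fin d → ℝ) 1, |tensorLagrange v y| ≤ Λ)
    (j : ℕ) (x : Fin d → ℝ) :
    ∑ t : (Fin d → Fin (2 ^ j + 1)) × (Fin d → Fin (r + 1)),
      cellBasis j (fun a => (t.1 a : ℕ)) t.2 x ^ 2 ≤ (√((r + 1 : ℝ) ^ d) * Λ) ^ 2 := by
  rw [Fintype.sum_prod_type, mul_pow, Real.sq_sqrt (by positivity)]
  have h1 : ∀ q : Fin d → Fin (2 ^ j + 1), ∑ v : Fin d → Fin (r + 1),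
      cellBasis j (fun a => (q a : ℕ)) v x ^ 2 ≤
      (dyadicCell j fun a => (q a : ℕ)).indicator (fun _ => (r + 1 : ℝ) ^ d * Λ ^ 2) x := by
    intro q
    calc _ ≤ ∑ _v : Fin d → Fin (r + 1),
          (dyadicCell j fun a => (q a : ℕ)).indicator (fun _ => Λ) x ^ 2 := by
          refine Finset.sum_le_sum fun v _ => ?_
          rw [← sq_abs]
          exact pow_le_pow_left₀ (abs_nonneg _) (abs_cellBasis_le hΛ _ _ _ _) 2
      _ = _ := by
          by_cases hx : x ∈ dyadicCell j fun a => (q a : ℕ) <;> simp [hx]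
  refine (Finset.sum_le_sum fun q _ => h1 q).trans ?_
  by_cases hx : ∃ q : Fin d → Fin (2 ^ j + 1), x ∈ dyadicCell j fun a => (q a : ℕ)
  · obtain ⟨q, hq⟩ := hx
    rw [Finset.sum_eq_single q]
    · rw [Set.indicator_of_mem hq]
    · intro q' _ hne
      refine Set.indicator_of_notMem (fun h => hne ?_) _
      funext a
      exact Fin.ext (congrFun ((eq_floor_of_mem_dyadicCell h).trans
        (eq_floor_of_mem_dyadicCell hq).symm) a)
    · simp
  · push Not at hx
    rw [Finset.sum_eq_zero fun q _ => Set.indicator_of_notMem (hx q) _]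
    positivity

/-- A random variable that dominates the deviation of the empirical measure uniformly over the
Hölder class, with the optimal rate in expectation. -/
theorem exists_integrable_deviation_bound {d : ℕ} (hd : 1 ≤ d) (r : ℕ) {β : ℝ} (hβ : 0 < β) :
    ∃ C : ℝ, 0 < C ∧ ∀ n : ℕ, 1 ≤ n → ∀ (μ : Measure (Fin d → ℝ)) [IsProbabilityMeasure μ],
      μ (Set.Icc (0 : Fin d → ℝ) 1)ᶜ = 0 →
      ∀ (Ω : Type*) [MeasurableSpace Ω] (P : Measure Ω) [IsProbabilityMeasure P]
        (X : Fin n → Ω → (Fin d → ℝ)), (∀ i, HasLaw (X i) μ P) → iIndepFun X P →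
      ∃ Z : Ω → ℝ, Integrable Z P ∧ ∫ ω, Z ω ∂P ≤ C * empiricalRate d ((r : ℝ) + β) n ∧
        ∀ ω, (∀ i, X i ω ∈ Set.Icc (0 : Fin d → ℝ) 1) → ∀ f ∈ holderClass d r β,
          (∫ x, f x ∂μ) - ∫ x, f x ∂empiricalMeasure (fun i => X i ω) ≤ Z ω := by
  have hα : (0 : ℝ) < (r : ℝ) + β := by positivity
  obtain ⟨Λ, hΛ0, hΛ⟩ := exists_abs_tensorLagrange_le d r
  obtain ⟨C₀, hC₀, hrate⟩ := exists_scale_sum_le hd hα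
  set A : ℝ := 1 + (d : ℝ) ^ r * (1 + 2 ^ ((r : ℝ) + β)) with hA
  set B : ℝ := √((r + 1 : ℝ) ^ d) * Λ with hBdef
  set D : ℝ := A * (2 ^ ((d : ℝ) / 2) * √((r + 1 : ℝ) ^ d) * B) with hD
  have hA0 : 0 < A := by positivity
  have hB0 : 0 < B := by positivity
  refine ⟨(D + 2 * (d : ℝ) ^ r) * C₀, by positivity, fun n hn μ _ hμ Ω _ P _ X hX hi => ?_⟩
  obtain ⟨J, hJ1, hJ2⟩ := hrate n hn
  have hbm : ∀ (j : ℕ) (t : (Fin d → Fin (2 ^ j + 1)) × (Fin d → Fin (r + 1))),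
      Measurable (cellBasis j (fun a => (t.1 a : ℕ)) t.2) := fun j t => measurable_cellBasis _ _ _
  have hbb : ∀ (j : ℕ) (t : (Fin d → Fin (2 ^ j + 1)) × (Fin d → Fin (r + 1))) (x : Fin d → ℝ),
      |cellBasis j (fun a => (t.1 a : ℕ)) t.2 x| ≤ Λ := fun j t x =>
    (abs_cellBasis_le hΛ _ _ _ _).trans (Set.indicator_le_self' (fun _ _ => hΛ0.le) x)
  have hbi : ∀ (j : ℕ) (t : (Fin d → Fin (2 ^ j + 1)) × (Fin d → Fin (r + 1))),
      Integrable (cellBasis j (fun a => (t.1 a : ℕ)) t.2) μ := fun j t =>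
    Integrable.of_bound (hbm j t).aestronglyMeasurable Λ (.of_forall (hbb j t))
  -- The fluctuation at scale `j`. It involves the fixed basis only; `f` enters later through
  -- coefficients bounded uniformly over the class.
  set S : ℕ → Ω → ℝ := fun j ω =>
    ∑ t : (Fin d → Fin (2 ^ j + 1)) × (Fin d → Fin (r + 1)),
      |deviation μ X (cellBasis j (fun a => (t.1 a : ℕ)) t.2) ω| with hS
  have hSi : ∀ j, Integrable (S j) P := fun j => integrable_finsetSum _ fun t _ =>
    ((memLp_deviation hn hX (hbm j t) (hbb j t)).integrable one_le_two).abs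
  have hSint : ∀ j, ∫ ω, S j ω ∂P ≤
      (2 ^ ((d : ℝ) / 2) * √((r + 1 : ℝ) ^ d) * B) *
        (((2 : ℝ) ^ j) ^ ((d : ℝ) / 2) * (n : ℝ) ^ (-(1 / 2 : ℝ))) := fun j => by
    refine (integral_sum_abs_deviation_le hn hX hi (hbm j) hB0.le
      (sum_sq_cellBasis_le hΛ j)).trans ?_
    have h1 : √((Fintype.card ((Fin d → Fin (2 ^ j + 1)) × (Fin d → Fin (r + 1))) : ℝ)) ≤
        2 ^ ((d : ℝ) / 2) * ((2 : ℝ) ^ j) ^ ((d : ℝ) / 2) * √((r + 1 : ℝ) ^ d) := by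
      have h2 : (Fintype.card ((Fin d → Fin (2 ^ j + 1)) × (Fin d → Fin (r + 1))) : ℝ) =
          ((2 : ℝ) ^ j + 1) ^ d * (r + 1 : ℝ) ^ d := by simp
      have h3 : (2 : ℝ) ^ j + 1 ≤ 2 * 2 ^ j := by
        linarith [one_le_pow₀ (one_le_two (α := ℝ)) (n := j)]
      rw [h2, Real.sqrt_mul (by positivity), ← Real.mul_rpow zero_le_two (by positivity)]
      gcongr
      rw [Real.sqrt_eq_rpow, ← Real.rpow_natCast, ← Real.rpow_mul (by positivity),
        mul_one_div]
      gcongr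
    calc _ ≤ (2 ^ ((d : ℝ) / 2) * ((2 : ℝ) ^ j) ^ ((d : ℝ) / 2) * √((r + 1 : ℝ) ^ d)) * B *
          (n : ℝ) ^ (-(1 / 2 : ℝ)) := by gcongr
      _ = _ := by ring
  refine ⟨fun ω => (∑ j ∈ Finset.range (J + 1), A * (1 / 2 ^ j : ℝ) ^ ((r : ℝ) + β) * S j ω) +
    2 * ((d : ℝ) ^ r * (1 / 2 ^ J) ^ ((r : ℝ) + β)),
    (integrable_finsetSum _ fun j _ => (hSi j).const_mul _).add (integrable_const _), ?_, ?_⟩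
  · rw [integral_add (integrable_finsetSum _ fun j _ => (hSi j).const_mul _) (integrable_const _),
      integral_finsetSum _ fun j _ => (hSi j).const_mul _]
    simp only [integral_const_mul, integral_const, probReal_univ, one_smul]
    have h1 : ∑ j ∈ Finset.range (J + 1),
        A * (1 / 2 ^ j : ℝ) ^ ((r : ℝ) + β) * ∫ ω, S j ω ∂P ≤
        D * ((n : ℝ) ^ (-(1 / 2 : ℝ)) * ∑ j ∈ Finset.range (J + 1),
          ((1 / 2 ^ j : ℝ) ^ ((r : ℝ) + β) * ((2 : ℝ) ^ j) ^ ((d : ℝ) / 2))) := by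
      rw [Finset.mul_sum, Finset.mul_sum]
      refine Finset.sum_le_sum fun j _ => ?_
      calc _ ≤ A * (1 / 2 ^ j : ℝ) ^ ((r : ℝ) + β) *
            ((2 ^ ((d : ℝ) / 2) * √((r + 1 : ℝ) ^ d) * B) *
            (((2 : ℝ) ^ j) ^ ((d : ℝ) / 2) * (n : ℝ) ^ (-(1 / 2 : ℝ)))) := by
            gcongr
            exact hSint j
        _ = _ := by
            rw [hD]
            ring
    have hD0 : 0 ≤ D := by positivity
    have h2 := mul_le_mul_of_nonneg_left hJ1 hD0
    have h3 := mul_le_mul_of_nonneg_left hJ2 (by positivity : (0 : ℝ) ≤ 2 * (d : ℝ) ^ r)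
    linarith
  · intro ω hω f hf
    set g : (Fin d → ℝ) → ℝ := fun x => ∑ j ∈ Finset.range (J + 1),
      ∑ t : (Fin d → Fin (2 ^ j + 1)) × (Fin d → Fin (r + 1)),
        cellCoeff f j (fun a => t.1 a) t.2 * cellBasis j (fun a => (t.1 a : ℕ)) t.2 x with hg
    have hgi : ∀ j, Integrable (fun x =>
        ∑ t : (Fin d → Fin (2 ^ j + 1)) × (Fin d → Fin (r + 1)),
          cellCoeff f j (fun a => t.1 a) t.2 * cellBasis j (fun a => (t.1 a : ℕ)) t.2 x) μ :=
      fun j => integrable_finsetSum _ fun t _ => (hbi j t).const_mul _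
    have hfi : Integrable f μ :=
      Integrable.of_bound (continuous_of_mem_holderClass hf).aestronglyMeasurable 1
        (.of_forall (abs_le_one_of_mem_holderClass hf))
    have hfg : ∀ x ∈ Set.Icc (0 : Fin d → ℝ) 1,
        |f x - g x| ≤ (d : ℝ) ^ r * (1 / 2 ^ J) ^ ((r : ℝ) + β) := fun x hx => by
      have := abs_sub_sum_cellBasis_le hβ hf J hx
      simpa only [hg, Fintype.sum_prod_type] using this
    have h1 := deviation_le_add (X := X) hn (mem_ae_iff.2 hμ) hω hfi
      (integrable_finsetSum _ fun j _ => hgi j) hfg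
    have h2 : deviation μ X g ω ≤
        ∑ j ∈ Finset.range (J + 1), A * (1 / 2 ^ j : ℝ) ^ ((r : ℝ) + β) * S j ω := by
      rw [hg, deviation_sum _ fun j _ => hgi j]
      refine Finset.sum_le_sum fun j _ => ?_
      rw [deviation_sum _ fun t _ => (hbi j t).const_mul _, hS, Finset.mul_sum]
      refine Finset.sum_le_sum fun t _ => ?_
      rw [deviation_const_mul]
      refine (le_abs_self _).trans ?_
      rw [abs_mul]
      gcongr
      exact abs_cellCoeff_le hβ hf j _ _
    rw [integral_empiricalMeasure]
    change deviation μ X f ω ≤ _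
    linarith

/-! ### Weight norms of networks -/

section Norm

attribute [local instance] Matrix.linftyOpNormedAddCommGroup

lemma Matrix.sum_abs_le_linftyOpNorm {m n : Type*} [Fintype m] [Fintype n] (A : Matrix m n ℝ)
    (i : m) : ∑ j, |A i j| ≤ ‖A‖ := by
  rw [Matrix.linfty_opNorm_def]
  have := Finset.le_sup (f := fun i => ∑ j, ‖A i j‖₊) (Finset.mem_univ i)
  have h2 : ((∑ j, ‖A i j‖₊ : NNReal) : ℝ) ≤ _ := NNReal.coe_le_coe.2 this
  simpa using h2

lemma Matrix.linftyOpNorm_le {m n : Type*} [Fintype m] [Fintype n] {A : Matrix m n ℝ} {c : ℝ}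
    (hc : 0 ≤ c) (h : ∀ i, ∑ j, |A i j| ≤ c) : ‖A‖ ≤ c := by
  rw [Matrix.linfty_opNorm_def]
  lift c to NNReal using hc
  refine NNReal.coe_le_coe.2 (Finset.sup_le fun i _ => ?_)
  rw [← NNReal.coe_le_coe]
  simpa using h i

lemma Matrix.sum_abs_fromCols {m n : Type*} [Fintype n] (A : Matrix m n ℝ)
    (b : m → ℝ) (i : m) :
    ∑ j, |Matrix.fromCols A (Matrix.replicateCol (Fin 1) b) i j| = ∑ j, |A i j| + |b i| := by
  simp

namespace ReLUNet

lemma kappa_nonneg {k m L : ℕ} (θ : ReLUNet k m L) : 0 ≤ θ.kappa := by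
  induction θ with
  | output A => exact norm_nonneg _
  | hidden N hN A b θ ih =>
    exact mul_nonneg (zero_le_one.trans (le_max_right _ _)) ih

lemma kappa_hidden_le {k m N L : ℕ} (hN : 0 < N) (A : Matrix (Fin N) (Fin m) ℝ) (b : Fin N → ℝ)
    (θ : ReLUNet k N L) (h : ∀ i, ∑ j, |A i j| + |b i| ≤ 1) :
    (hidden N hN A b θ).kappa ≤ θ.kappa := by
  rw [kappa, max_eq_right, one_mul]
  exact Matrix.linftyOpNorm_le zero_le_one fun i => by
    rw [Matrix.sum_abs_fromCols]
    exact h i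

lemma kappa_output_le {m : ℕ} (c : Fin m → ℝ) :
    (output (k := 1) (Matrix.of fun _ j => c j)).kappa ≤ ∑ j, |c j| := by
  rw [kappa]
  exact Matrix.linftyOpNorm_le (by positivity) fun i => le_of_eq (by simp)

/-- The matrix of `x ↦ A (x ∘ s)`. -/
def selectMatrix {n N d : ℕ} (s : Fin N → Fin d) (A : Matrix (Fin n) (Fin N) ℝ) :
    Matrix (Fin n) (Fin d) ℝ :=
  Matrix.of fun i j => ∑ l, if s l = j then A i l else 0

lemma selectMatrix_mulVec {n N d : ℕ} (s : Fin N → Fin d) (A : Matrix (Fin n) (Fin N) ℝ)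
    (x : Fin d → ℝ) : (selectMatrix s A).mulVec x = A.mulVec fun i => x (s i) := by
  funext i
  simp only [selectMatrix, Matrix.mulVec, dotProduct, Matrix.of_apply, Finset.sum_mul]
  rw [Finset.sum_comm]
  simp

lemma sum_abs_selectMatrix_le {n N d : ℕ} (s : Fin N → Fin d) (A : Matrix (Fin n) (Fin N) ℝ)
    (i : Fin n) : ∑ j, |selectMatrix s A i j| ≤ ∑ l, |A i l| := by
  calc _ ≤ ∑ j, ∑ l, |if s l = j then A i l else 0| :=
        Finset.sum_le_sum fun j _ => Finset.abs_sum_le_sum_abs _ _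
    _ = _ := by
        rw [Finset.sum_comm]
        refine Finset.sum_congr rfl fun l _ => ?_
        simp [apply_ite abs]

/-- Precomposition of a network with a selection of coordinates. -/
lemma exists_comp_select {k N M d : ℕ} (θ : ReLUNet k N M) (s : Fin N → Fin d) :
    ∃ θ' : ReLUNet k d M, (∀ x, θ'.eval x = θ.eval fun i => x (s i)) ∧
      θ'.kappa ≤ θ.kappa ∧ θ'.width = θ.width := by
  cases θ with
  | output A =>
    refine ⟨.output (selectMatrix s A), fun x => selectMatrix_mulVec s A x, ?_, rfl⟩
    exact Matrix.linftyOpNorm_le (norm_nonneg _) fun i =>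
      (sum_abs_selectMatrix_le s A i).trans (Matrix.sum_abs_le_linftyOpNorm A i)
  | hidden n hn A b θ =>
    refine ⟨.hidden n hn (selectMatrix s A) b θ, fun x => ?_, ?_, rfl⟩
    · simp only [eval]
      rw [selectMatrix_mulVec s A x]
    · simp only [kappa]
      refine mul_le_mul_of_nonneg_right (max_le_max_right _ ?_) (kappa_nonneg θ)
      refine Matrix.linftyOpNorm_le (norm_nonneg _) fun i => ?_
      refine le_trans ?_ (Matrix.sum_abs_le_linftyOpNorm _ i)
      rw [Matrix.sum_abs_fromCols, Matrix.sum_abs_fromCols]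
      linarith [sum_abs_selectMatrix_le s A i]

end ReLUNet

end Norm

/-! ### Calculus of normalized hidden layers -/

/-- `HiddenFamily d w L ι u` says that the functions `u i` are the outputs of the last of `L`
hidden layers, all of size at most `w`, whose rows `(A_i, b_i)` have `1`-norm at most `1`. -/
def HiddenFamily (d w : ℕ) : ℕ → (ι : Type) → [Fintype ι] → (ι → (Fin d → ℝ) → ℝ) → Prop
  | 0, ι, _, u => Nonempty ι ∧ ∃ e : ι → Fin d, ∀ i x, u i x = x (e i)
  | L + 1, ι, _, u => Nonempty ι ∧ Fintype.card ι ≤ w ∧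
      ∃ (κ : Type) (_ : Fintype κ) (v : κ → (Fin d → ℝ) → ℝ) (A : Matrix ι κ ℝ) (b : ι → ℝ),
        HiddenFamily d w L κ v ∧ (∀ i, ∑ k, |A i k| + |b i| ≤ 1) ∧
        ∀ i x, u i x = max (∑ k, A i k * v k x + b i) 0

namespace HiddenFamily

variable {d w w₁ w₂ L : ℕ} {ι κ : Type} [Fintype ι] [Fintype κ]
  {u : ι → (Fin d → ℝ) → ℝ} {v : κ → (Fin d → ℝ) → ℝ}

lemma nonempty (h : HiddenFamily d w L ι u) : Nonempty ι := by
  cases L <;> exact h.1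

lemma mono (hw : w₁ ≤ w₂) (h : HiddenFamily d w₁ L ι u) : HiddenFamily d w₂ L ι u := by
  induction L generalizing ι with
  | zero => exact h
  | succ L ih =>
    obtain ⟨hne, hc, κ, _, v, A, b, hv, hA, hu⟩ := h
    exact ⟨hne, hc.trans hw, κ, _, v, A, b, ih hv, hA, hu⟩

/-- Networks side by side: block diagonal weights leave the `1`-norms of the rows unchanged, while
sizes add. -/
lemma sumElim (hu : HiddenFamily d w₁ L ι u) (hv : HiddenFamily d w₂ L κ v) :
    HiddenFamily d (w₁ + w₂) L (ι ⊕ κ) (Sum.elim u v) := by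
  induction L generalizing ι κ with
  | zero =>
    obtain ⟨_, e, he⟩ := hu
    obtain ⟨_, e', he'⟩ := hv
    refine ⟨inferInstance, Sum.elim e e', ?_⟩
    rintro (i | i) x
    · exact he i x
    · exact he' i x
  | succ L ih =>
    obtain ⟨_, hc, κ₁, _, v₁, A₁, b₁, hv₁, hA₁, hu₁⟩ := hu
    obtain ⟨_, hc', κ₂, _, v₂, A₂, b₂, hv₂, hA₂, hu₂⟩ := hv
    refine ⟨inferInstance, by rw [Fintype.card_sum]; omega, κ₁ ⊕ κ₂, inferInstance,
      Sum.elim v₁ v₂, Matrix.fromBlocks A₁ 0 0 A₂, Sum.elim b₁ b₂, ih hv₁ hv₂, ?_, ?_⟩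
    · rintro (i | i)
      · simpa using hA₁ i
      · simpa using hA₂ i
    · rintro (i | i) x
      · simpa using hu₁ i x
      · simpa using hu₂ i x

lemma eval_nonneg (h : HiddenFamily d w (L + 1) ι u) (i : ι) (x : Fin d → ℝ) : 0 ≤ u i x := by
  obtain ⟨_, _, _, _, _, _, _, _, _, hu⟩ := h
  rw [hu]
  exact le_max_right _ _

/-- Outputs of a ReLU layer are nonnegative, so an identity layer, whose rows have norm `1`,
reproduces them. -/
lemma succ_depth (h : HiddenFamily d w (L + 1) ι u) : HiddenFamily d w (L + 2) ι u := by
  classical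
  refine ⟨h.nonempty, h.2.1, ι, inferInstance, u, 1, 0, h, fun i => ?_, fun i x => ?_⟩
  · simp [Matrix.one_apply, apply_ite abs]
  · simp [Matrix.one_apply, h.eval_nonneg i x]

lemma reindex (e : κ ≃ ι) (h : HiddenFamily d w (L + 1) ι u) :
    HiddenFamily d w (L + 1) κ fun k => u (e k) := by
  obtain ⟨hne, hc, κ', _, v, A, b, hv, hA, hu⟩ := h
  exact ⟨e.nonempty, (Fintype.card_congr e).trans_le hc, κ', inferInstance, v,
    Matrix.of fun k => A (e k), fun k => b (e k), hv, fun k => hA (e k), fun k x => hu (e k) x⟩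

/-- A family of size exactly `w` obtained by adding copies of one of its members. -/
lemma exists_pad (h : HiddenFamily d w (L + 1) ι u) (c : ι → ℝ) :
    ∃ (u' : Fin w → (Fin d → ℝ) → ℝ) (c' : Fin w → ℝ), HiddenFamily d w (L + 1) (Fin w) u' ∧
      ∑ j, |c' j| = ∑ i, |c i| ∧ ∀ x, ∑ j, c' j * u' j x = ∑ i, c i * u i x := by
  obtain ⟨⟨i₀⟩, hc, κ, _, v, A, b, hv, hA, hu⟩ := h
  have hcard : Fintype.card (Fin w) = Fintype.card (ι ⊕ Fin (w - Fintype.card ι)) := by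
    simp only [Fintype.card_sum, Fintype.card_fin]
    omega
  let e := Fintype.equivOfCardEq hcard
  have hfam : HiddenFamily d w (L + 1) (ι ⊕ Fin (w - Fintype.card ι))
      (Sum.elim u fun _ => u i₀) := by
    refine ⟨⟨Sum.inl i₀⟩, by simpa using hcard.ge, κ, inferInstance, v,
      Matrix.of (Sum.elim A fun _ => A i₀), Sum.elim b fun _ => b i₀, hv, ?_, ?_⟩
    · rintro (i | i)
      · exact hA i
      · exact hA i₀
    · rintro (i | i) x
      · exact hu i x
      · exact hu i₀ x
  -- The added copies receive output coefficient `0`.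
  refine ⟨_, fun j => (Sum.elim c 0 : ι ⊕ Fin (w - Fintype.card ι) → ℝ) (e j),
    hfam.reindex e, ?_, fun x => ?_⟩
  · rw [e.sum_comp fun s => |(Sum.elim c 0 : ι ⊕ Fin (w - Fintype.card ι) → ℝ) s|]
    simp
  · rw [e.sum_comp fun s => (Sum.elim c 0 : ι ⊕ Fin (w - Fintype.card ι) → ℝ) s *
      (Sum.elim u fun _ => u i₀ : ι ⊕ Fin (w - Fintype.card ι) → (Fin d → ℝ) → ℝ) s x]
    simp

/-- The layers are peeled off from the last one towards the input and stacked in front of `θ`.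
Normalized layers have factor `1` in `κ`. The lower bounds on the width are what later forces it to
equal the prescribed value. -/
lemma exists_comp_net (h : HiddenFamily d w L ι u) {N M K : ℕ} (hK : K = M + L) (e : ι ≃ Fin N)
    (θ : ReLUNet 1 N M) : ∃ θ' : ReLUNet 1 d K,
      (∀ x, θ'.eval x = θ.eval fun i => u (e.symm i) x) ∧ θ'.kappa ≤ θ.kappa ∧
      θ'.width ≤ max w θ.width ∧ θ.width ≤ θ'.width ∧ (L ≠ 0 → N ≤ θ'.width) := by
  induction L generalizing ι N M K with
  | zero =>
    obtain ⟨_, s, hs⟩ := h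
    subst hK
    obtain ⟨θ', h1, h2, h3⟩ := θ.exists_comp_select fun i => s (e.symm i)
    refine ⟨θ', fun x => ?_, h2, h3.le.trans (le_max_right _ _), h3.ge, fun h => absurd rfl h⟩
    simp only [h1, hs]
  | succ L ih =>
    obtain ⟨hne, hc, κ, _, v, A, b, hv, hA, hu⟩ := h
    have hN : Fintype.card ι = N := by simpa using Fintype.card_congr e
    have hN0 : 0 < N := hN ▸ Fintype.card_pos
    let e' := Fintype.equivFin κ
    obtain ⟨θ', h1, h2, h3, h4, -⟩ := ih hv (K := K) (M := M + 1) (by omega) e'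
      (.hidden N hN0 (Matrix.of fun i j => A (e.symm i) (e'.symm j)) (fun i => b (e.symm i)) θ)
    refine ⟨θ', fun x => ?_, h2.trans ?_, h3.trans ?_, le_trans (le_max_right _ _) h4,
      fun _ => le_trans (le_max_left _ _) h4⟩
    · rw [h1, ReLUNet.eval]
      congr 1
      funext i
      rw [hu, Matrix.mulVec, dotProduct]
      congr 2
      exact e'.symm.sum_comp fun k => A (e.symm i) k * v k x
    · refine ReLUNet.kappa_hidden_le _ _ _ _ fun i => ?_
      have h5 : ∑ j, |A (e.symm i) (e'.symm j)| = ∑ k, |A (e.symm i) k| :=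
        e'.symm.sum_comp fun k => |A (e.symm i) k|
      simpa only [Matrix.of_apply, h5] using hA (e.symm i)
    · rw [ReLUNet.width]
      refine max_le (le_max_left _ _) (max_le ?_ (le_max_right _ _))
      exact (hN.ge.trans hc).trans (le_max_left _ _)

end HiddenFamily

/-- `NetSpan d w L C f` says that `f` is a linear combination, with coefficients of `1`-norm at
most `C`, of the outputs of `L` normalized hidden layers of size at most `w`. -/
def NetSpan (d w L : ℕ) (C : ℝ) (f : (Fin d → ℝ) → ℝ) : Prop :=
  ∃ (ι : Type) (_ : Fintype ι) (u : ι → (Fin d → ℝ) → ℝ) (c : ι → ℝ),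
    HiddenFamily d w L ι u ∧ ∑ i, |c i| ≤ C ∧ ∀ x, f x = ∑ i, c i * u i x

namespace NetSpan

variable {d w w₁ w₂ L : ℕ} {C C₁ C₂ : ℝ} {f g : (Fin d → ℝ) → ℝ}

lemma mono (hw : w₁ ≤ w₂) (hC : C₁ ≤ C₂) (h : NetSpan d w₁ L C₁ f) : NetSpan d w₂ L C₂ f := by
  obtain ⟨ι, _, u, c, hu, hc, hf⟩ := h
  exact ⟨ι, _, u, c, hu.mono hw, hc.trans hC, hf⟩

lemma congr (h : NetSpan d w L C f) (hfg : ∀ x, g x = f x) : NetSpan d w L C g := by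
  obtain rfl : g = f := funext hfg
  exact h

lemma coord (w : ℕ) (a : Fin d) : NetSpan d w 0 1 fun x => x a :=
  ⟨Unit, inferInstance, fun _ x => x a, fun _ => 1,
    ⟨inferInstance, fun _ => a, fun _ _ => rfl⟩, by simp, by simp⟩

lemma const_mul (a : ℝ) (h : NetSpan d w L C f) : NetSpan d w L (|a| * C) fun x => a * f x := by
  obtain ⟨ι, _, u, c, hu, hc, hf⟩ := h
  refine ⟨ι, _, u, fun i => a * c i, hu, ?_, fun x => ?_⟩
  · simp_rw [abs_mul, ← Finset.mul_sum]
    gcongr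
  · simp_rw [hf, Finset.mul_sum, mul_assoc]

lemma add (hf : NetSpan d w₁ L C₁ f) (hg : NetSpan d w₂ L C₂ g) :
    NetSpan d (w₁ + w₂) L (C₁ + C₂) fun x => f x + g x := by
  obtain ⟨ι, _, u, c, hu, hc, hf⟩ := hf
  obtain ⟨κ, _, v, c', hv, hc', hg⟩ := hg
  refine ⟨ι ⊕ κ, inferInstance, _, Sum.elim c c', hu.sumElim hv, ?_, fun x => ?_⟩
  · simpa using add_le_add hc hc'
  · simp [hf, hg]

lemma sum {T : Type*} {s : Finset T} (hs : s.Nonempty) {F : T → (Fin d → ℝ) → ℝ}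
    (h : ∀ t ∈ s, NetSpan d w L C (F t)) :
    NetSpan d (s.card * w) L (s.card * C) fun x => ∑ t ∈ s, F t x := by
  induction hs using Finset.Nonempty.cons_induction with
  | singleton t => simpa using h t
  | cons t s ht hs ih =>
    have h1 := (h t (Finset.mem_cons_self _ _)).add
      (ih fun t ht => h t (Finset.mem_cons_of_mem ht))
    simp only [Finset.sum_cons, Finset.card_cons]
    refine h1.mono (le_of_eq ?_) (le_of_eq ?_)
    · ring
    · push_cast
      ring

/-- A layer of shifted units applied to a single function. -/
lemma relu_sum (h : NetSpan d w L C f) {J : Type} [Fintype J] [Nonempty J]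
    (hJ : Fintype.card J ≤ w) {B : ℝ} (hCB : 0 < C + B) (γ b : J → ℝ) (hb : ∀ j, |b j| ≤ B) :
    NetSpan d w (L + 1) ((C + B) * ∑ j, |γ j|) fun x => ∑ j, γ j * max (f x + b j) 0 := by
  obtain ⟨ι, _, u, c, hu, hc, hf⟩ := h
  -- Dividing the rows by `C + B` normalizes them; by positive homogeneity of ReLU the factor moves
  -- to the output coefficients.
  refine ⟨J, inferInstance, fun j x => max (∑ i, (c i / (C + B)) * u i x + b j / (C + B)) 0,
    fun j => (C + B) * γ j,
    ⟨inferInstance, hJ, ι, inferInstance, u, Matrix.of fun _ i => c i / (C + B),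
      fun j => b j / (C + B), hu, fun j => ?_, fun j x => rfl⟩, ?_, fun x => ?_⟩
  · simp only [Matrix.of_apply, abs_div, abs_of_pos hCB]
    rw [← Finset.sum_div, ← add_div, div_le_one hCB]
    exact add_le_add hc (hb j)
  · simp_rw [abs_mul, abs_of_pos hCB, ← Finset.mul_sum]
    exact le_rfl
  · refine Finset.sum_congr rfl fun j _ => ?_
    have h1 : ∑ i, (c i / (C + B)) * u i x + b j / (C + B) = (f x + b j) / (C + B) := by
      rw [hf, add_div, Finset.sum_div]
      congr 1
      exact Finset.sum_congr rfl fun i _ => by ring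
    have h2 : max ((f x + b j) / (C + B)) 0 = max (f x + b j) 0 / (C + B) := by
      rw [← max_div_div_right hCB.le, zero_div]
    change _ = (C + B) * γ j *
      max (∑ i, (c i / (C + B)) * u i x + b j / (C + B)) 0
    rw [h1, h2]
    field_simp

lemma of_depth_le {L L' : ℕ} (hL : L ≤ L') (h : NetSpan d w (L + 1) C f) :
    NetSpan d w (L' + 1) C f := by
  induction L', hL using Nat.le_induction with
  | base => exact h
  | succ n _ ih =>
    obtain ⟨ι, _, u, c, hu, hc, hf⟩ := ih
    exact ⟨ι, _, u, c, hu.succ_depth, hc, hf⟩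

/-- Realization by a network of prescribed width and depth. -/
lemma exists_net (h : NetSpan d w (L + 1) C f) : ∃ θ : ReLUNet 1 d (L + 1),
    θ.width = w ∧ θ.kappa ≤ C ∧ ∀ x, θ.toFun x = f x := by
  obtain ⟨ι, _, u, c, hu, hc, hf⟩ := h
  obtain ⟨u', c', hu', hc', hf'⟩ := hu.exists_pad c
  obtain ⟨θ, h1, h2, h3, -, h5⟩ := hu'.exists_comp_net (K := L + 1) (M := 0) (by omega)
    (Equiv.refl _) (.output (Matrix.of fun _ j => c' j))
  refine ⟨θ, le_antisymm (h3.trans (by simp [ReLUNet.width])) (h5 (Nat.succ_ne_zero _)),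
    (h2.trans (ReLUNet.kappa_output_le c')).trans (hc'.le.trans hc), fun x => ?_⟩
  rw [ReLUNet.toFun, h1, hf, ← hf']
  rfl

end NetSpan

/-! ### Approximate squares and products -/

/-- For `0 ≤ t ≤ 1`, the piecewise linear interpolation of `t²` at the points `j / k`; for
`t ≤ 0` it vanishes. -/
noncomputable def sqRelu (k : ℕ) (t : ℝ) : ℝ :=
  ∑ j : Fin k, (if j.1 = 0 then 1 / (k : ℝ) else 2 / k) * max (t + -((j : ℝ) / k)) 0

lemma sqRelu_of_nonpos (k : ℕ) {t : ℝ} (ht : t ≤ 0) : sqRelu k t = 0 := by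
  refine Finset.sum_eq_zero fun j _ => ?_
  have : 0 ≤ (j : ℝ) / k := by positivity
  rw [max_eq_right (by linarith), mul_zero]

/-- Adding the slopes `1, 2, 2, …` gives slope `2k + 1`: the result is the chord of `y²` through `k`
and `k + 1`. -/
lemma sum_range_relu_eq (k : ℕ) {y : ℝ} (hy : (k : ℝ) ≤ y) :
    ∑ j ∈ Finset.range (k + 1), (if j = 0 then (1 : ℝ) else 2) * max (y - j) 0 =
      (2 * k + 1) * y - k ^ 2 - k := by
  induction k with
  | zero =>
    have : 0 ≤ y := by simpa using hy
    simp [this]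
  | succ k ih =>
    push_cast at hy
    rw [Finset.sum_range_succ, ih (by linarith), if_neg (Nat.succ_ne_zero k),
      max_eq_left (by push_cast; linarith)]
    push_cast
    ring

lemma sqRelu_eq {k : ℕ} (hk : 1 ≤ k) {t : ℝ} {p : ℕ} (hp : p < k) (h1 : (p : ℝ) ≤ k * t)
    (h2 : k * t ≤ p + 1) :
    sqRelu k t = ((2 * p + 1) * (k * t) - p ^ 2 - p) / k ^ 2 := by
  have hk0 : (0 : ℝ) < k := by exact_mod_cast hk
  have h3 : sqRelu k t = (∑ j ∈ Finset.range k,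
      (if j = 0 then (1 : ℝ) else 2) * max (k * t - j) 0) / k ^ 2 := by
    rw [sqRelu, Finset.sum_range, Finset.sum_div]
    refine Finset.sum_congr rfl fun j _ => ?_
    have h4 : t + -((j : ℝ) / k) = (k * t - j) / k := by
      field_simp
      ring
    have h5 : max ((k * t - j) / k) 0 = max (k * t - j) 0 / k := by
      rw [← max_div_div_right hk0.le, zero_div]
    rw [h4, h5]
    split_ifs <;> field_simp
  rw [h3, ← sum_range_relu_eq p h1]
  congr 1
  symm
  refine Finset.sum_subset (Finset.range_mono hp) fun j _ hj => ?_
  have : p + 1 ≤ j := by simpa using hj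
  have : (p : ℝ) + 1 ≤ j := by exact_mod_cast this
  rw [max_eq_right (by linarith), mul_zero]

lemma sqRelu_bounds {k : ℕ} (hk : 1 ≤ k) {t : ℝ} (ht : t ∈ Set.Icc (0 : ℝ) 1) :
    0 ≤ sqRelu k t ∧ sqRelu k t ≤ 1 ∧ |sqRelu k t - t ^ 2| ≤ 1 / (k : ℝ) ^ 2 := by
  have hk0 : (0 : ℝ) < k := by exact_mod_cast hk
  obtain ⟨p, hp, h1, h2⟩ : ∃ p : ℕ, p < k ∧ (p : ℝ) ≤ k * t ∧ k * t ≤ p + 1 := by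
    rcases lt_or_ge ⌊k * t⌋₊ k with h | h
    · exact ⟨_, h, Nat.floor_le (mul_nonneg hk0.le ht.1), (Nat.lt_floor_add_one _).le⟩
    · have h3 : (k : ℝ) ≤ k * t := (Nat.le_floor_iff (mul_nonneg hk0.le ht.1)).1 h
      have h4 : k * t ≤ k := mul_le_of_le_one_right hk0.le ht.2
      -- This is the endpoint `t = 1`, assigned to the last interval.
      refine ⟨k - 1, by omega, ?_, ?_⟩ <;> rw [Nat.cast_sub hk] <;> push_cast <;> linarith
  have hpk : (p : ℝ) + 1 ≤ k := by exact_mod_cast hp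
  have hp0 : (0 : ℝ) ≤ p := Nat.cast_nonneg p
  rw [sqRelu_eq hk hp h1 h2]
  refine ⟨div_nonneg ?_ (by positivity), ?_, ?_⟩
  · nlinarith
  · rw [div_le_one (by positivity)]
    nlinarith
  · have h3 : ((2 * p + 1) * (k * t) - p ^ 2 - p) / (k : ℝ) ^ 2 - t ^ 2 =
        ((k * t - p) * (p + 1 - k * t)) / (k : ℝ) ^ 2 := by
      field_simp
      ring
    rw [h3, abs_of_nonneg (div_nonneg (mul_nonneg (by linarith) (by linarith)) (by positivity))]
    gcongr
    nlinarith

/-- The approximate square on `[-1, 1]`. -/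
noncomputable def apxSq (k : ℕ) (t : ℝ) : ℝ := sqRelu k t + sqRelu k (-t)

lemma apxSq_bounds {k : ℕ} (hk : 1 ≤ k) {t : ℝ} (ht : |t| ≤ 1) :
    0 ≤ apxSq k t ∧ apxSq k t ≤ 1 ∧ |apxSq k t - t ^ 2| ≤ 1 / (k : ℝ) ^ 2 := by
  rw [abs_le] at ht
  unfold apxSq
  rcases le_total t 0 with h | h
  · rw [sqRelu_of_nonpos k h, zero_add, ← neg_sq]
    exact sqRelu_bounds hk ⟨by linarith, by linarith⟩
  · rw [sqRelu_of_nonpos k (neg_nonpos.2 h), add_zero]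
    exact sqRelu_bounds hk ⟨h, ht.2⟩

/-- The approximate product on `[-1, 1]²`. -/
noncomputable def apxMul (k : ℕ) (x y : ℝ) : ℝ :=
  apxSq k (1 / 2 * (x + y)) - apxSq k (1 / 2 * (x + -1 * y))

/-- `apxSq` is even by construction, so the two squares cancel exactly. Exact zeros are needed to
preserve localization. -/
lemma apxMul_zero_left (k : ℕ) (y : ℝ) : apxMul k 0 y = 0 := by
  unfold apxMul apxSq
  ring_nf

lemma apxMul_zero_right (k : ℕ) (x : ℝ) : apxMul k x 0 = 0 := by
  simp [apxMul]

lemma apxMul_bounds {k : ℕ} (hk : 1 ≤ k) {x y : ℝ} (hx : |x| ≤ 1) (hy : |y| ≤ 1) :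
    |apxMul k x y| ≤ 1 ∧ |apxMul k x y - x * y| ≤ 2 / (k : ℝ) ^ 2 := by
  rw [abs_le] at hx hy
  obtain ⟨h1, h2, h3⟩ := apxSq_bounds hk (t := 1 / 2 * (x + y))
    (abs_le.2 ⟨by linarith, by linarith⟩)
  obtain ⟨h4, h5, h6⟩ := apxSq_bounds hk (t := 1 / 2 * (x + -1 * y))
    (abs_le.2 ⟨by linarith, by linarith⟩)
  refine ⟨abs_le.2 ⟨by unfold apxMul; linarith, by unfold apxMul; linarith⟩, ?_⟩
  have h7 : apxMul k x y - x * y = (apxSq k (1 / 2 * (x + y)) - (1 / 2 * (x + y)) ^ 2) -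
      (apxSq k (1 / 2 * (x + -1 * y)) - (1 / 2 * (x + -1 * y)) ^ 2) := by
    unfold apxMul
    ring
  rw [h7]
  refine (abs_sub _ _).trans ((add_le_add h3 h6).trans (le_of_eq ?_))
  ring

/-- The approximate product of `2^m` factors along a binary tree. -/
noncomputable def treeProd (k : ℕ) : ℕ → (ℕ → ℝ) → ℝ
  | 0, x => x 0
  | m + 1, x => apxMul k (treeProd k m x) (treeProd k m fun i => x (2 ^ m + i))

/-- A zero factor propagates exactly to the root, so a localized product stays supported where its
hat functions are, in spite of the approximate multiplications. -/
lemma treeProd_eq_zero (k m : ℕ) {x : ℕ → ℝ} {i : ℕ} (hi : i < 2 ^ m) (hx : x i = 0) :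
    treeProd k m x = 0 := by
  induction m generalizing x i with
  | zero =>
    obtain rfl : i = 0 := by simpa using hi
    exact hx
  | succ m ih =>
    rw [treeProd]
    rcases lt_or_ge i (2 ^ m) with h | h
    · rw [ih h hx, apxMul_zero_left]
    · rw [ih (i := i - 2 ^ m) (x := fun i => x (2 ^ m + i)) (by rw [pow_succ] at hi; omega)
        (by rw [Nat.add_sub_cancel' h]; exact hx), apxMul_zero_right]

/-- All intermediate values stay in `[-1, 1]`, so errors add without amplification: `2^m - 1`
multiplications, each with error at most `2 / k²`. -/
lemma treeProd_bounds {k : ℕ} (hk : 1 ≤ k) (m : ℕ) {x : ℕ → ℝ} (hx : ∀ i, |x i| ≤ 1) :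
    |treeProd k m x| ≤ 1 ∧
      |treeProd k m x - ∏ i ∈ Finset.range (2 ^ m), x i| ≤ (2 ^ m - 1) * (2 / (k : ℝ) ^ 2) := by
  induction m generalizing x with
  | zero => simpa [treeProd] using hx 0
  | succ m ih =>
    obtain ⟨h1, h2⟩ := ih hx
    obtain ⟨h3, h4⟩ := ih (x := fun i => x (2 ^ m + i)) fun i => hx _
    obtain ⟨h5, h6⟩ := apxMul_bounds hk h1 h3
    refine ⟨h5, ?_⟩
    have hprod : |∏ i ∈ Finset.range (2 ^ m), x i| ≤ 1 := by
      rw [Finset.abs_prod]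
      exact Finset.prod_le_one (fun _ _ => abs_nonneg _) fun i _ => hx i
    rw [treeProd, pow_succ, mul_two, Finset.prod_range_add]
    set a := treeProd k m x
    set b := treeProd k m fun i => x (2 ^ m + i)
    set p := ∏ i ∈ Finset.range (2 ^ m), x i
    set q := ∏ i ∈ Finset.range (2 ^ m), x (2 ^ m + i)
    have h7 : apxMul k a b - p * q = (apxMul k a b - a * b) + (a - p) * b + p * (b - q) := by ring
    have h8 : |(a - p) * b| ≤ (2 ^ m - 1) * (2 / (k : ℝ) ^ 2) := by
      rw [abs_mul]
      exact (mul_le_of_le_one_right (abs_nonneg _) h3).trans h2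
    have h9 : |p * (b - q)| ≤ (2 ^ m - 1) * (2 / (k : ℝ) ^ 2) := by
      rw [abs_mul]
      exact (mul_le_of_le_one_left (abs_nonneg _) hprod).trans h4
    rw [h7]
    refine (abs_add_three _ _ _).trans ((add_le_add (add_le_add h6 h8) h9).trans (le_of_eq ?_))
    ring

namespace NetSpan

variable {d w L k : ℕ} {C : ℝ} {f g : (Fin d → ℝ) → ℝ}

/-- The outer coefficients sum to at most `2` and the biases are at most `1`, so the norm is at most
`2(C + 1) ≤ 4C`. The number `k` of knots is paid for in width only. -/
lemma sqRelu (hk : 1 ≤ k) (hkw : k ≤ w) (hC : 1 ≤ C) (h : NetSpan d w L C f) :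
    NetSpan d w (L + 1) (4 * C) fun x => sqRelu k (f x) := by
  have : Nonempty (Fin k) := ⟨⟨0, hk⟩⟩
  have hk0 : (0 : ℝ) < k := by exact_mod_cast hk
  refine (h.relu_sum (J := Fin k) (by simpa using hkw) (B := 1) (by linarith)
    (fun j => if j.1 = 0 then 1 / (k : ℝ) else 2 / k) (fun j => -((j : ℝ) / k))
    fun j => ?_).mono le_rfl ?_
  · rw [abs_neg, abs_of_nonneg (by positivity), div_le_one hk0]
    exact_mod_cast j.2.le
  · have h1 : ∑ j : Fin k, |if j.1 = 0 then 1 / (k : ℝ) else 2 / k| ≤ 2 := by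
      calc _ ≤ ∑ _j : Fin k, (2 / k : ℝ) := by
            refine Finset.sum_le_sum fun j _ => ?_
            split_ifs
            · rw [abs_of_nonneg (by positivity)]
              gcongr
              norm_num
            · rw [abs_of_nonneg (by positivity)]
        _ = 2 := by
            simp
            field_simp
    nlinarith

lemma apxSq (hk : 1 ≤ k) (hkw : k ≤ w) (hC : 1 ≤ C) (h : NetSpan d w L C f) :
    NetSpan d (w + w) (L + 1) (8 * C) fun x => apxSq k (f x) := by
  have h1 : NetSpan d w L C fun x => -f x :=
    ((h.const_mul (-1)).mono le_rfl (by simp)).congr fun x => by ring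
  exact ((h.sqRelu hk hkw hC).add (h1.sqRelu hk hkw hC)).mono le_rfl (by linarith)

/-- The averages `(f ± g)/2` have width `2w` and norm `C`; squaring each gives width `4w` and norm
`8C`, and there are two squares. -/
lemma apxMul (hk : 1 ≤ k) (hkw : k ≤ w) (hC : 1 ≤ C) (hf : NetSpan d w L C f)
    (hg : NetSpan d w L C g) :
    NetSpan d (8 * w) (L + 1) (16 * C) fun x => apxMul k (f x) (g x) := by
  have h1 : NetSpan d (w + w) L C fun x => 1 / 2 * (f x + g x) :=
    ((hf.add hg).const_mul (1 / 2)).mono le_rfl (by rw [abs_of_pos] <;> norm_num; linarith)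
  have h2 : NetSpan d (w + w) L C fun x => 1 / 2 * (f x + -1 * g x) :=
    ((hf.add (hg.const_mul (-1))).const_mul (1 / 2)).mono le_rfl
      (by rw [abs_of_pos] <;> norm_num; linarith)
  have h3 := (h1.apxSq hk (by omega) hC).add ((h2.apxSq hk (by omega) hC).const_mul (-1))
  refine (h3.mono (by omega) ?_).congr fun x => ?_
  · norm_num
    linarith
  · simp only [_root_.apxMul]
    ring

lemma treeProd (hk : 1 ≤ k) (hkw : k ≤ w) (hC : 1 ≤ C) (m : ℕ) {F : ℕ → (Fin d → ℝ) → ℝ}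
    (hF : ∀ i, NetSpan d w L C (F i)) :
    NetSpan d (8 ^ m * w) (L + m) (16 ^ m * C) fun x => treeProd k m fun i => F i x := by
  induction m generalizing F with
  | zero => simpa [_root_.treeProd] using hF 0
  | succ m ih =>
    have h1 := (ih hF).apxMul hk (hkw.trans (Nat.le_mul_of_pos_left _ (by positivity)))
      (one_le_mul_of_one_le_of_one_le (one_le_pow₀ (by norm_num)) hC)
      (ih fun i => hF (2 ^ m + i))
    refine h1.mono (le_of_eq ?_) (le_of_eq ?_) <;> ring

end NetSpan

/-! ### Partition of unity and glued Taylor polynomials -/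

/-- The hat function `max (1 - |t|) 0`. -/
noncomputable def hat (t : ℝ) : ℝ := max (t + 1) 0 - 2 * max t 0 + max (t - 1) 0

/-- The truncation of `t` to `[-1, 1]`. -/
noncomputable def clamp (t : ℝ) : ℝ := max (t + 1) 0 - max (t - 1) 0 - 1

lemma hat_nonneg (t : ℝ) : 0 ≤ hat t := by
  unfold hat
  rcases max_cases (t + 1) 0 with h | h <;> rcases max_cases t 0 with h' | h' <;>
    rcases max_cases (t - 1) 0 with h'' | h'' <;> linarith

lemma hat_le_one (t : ℝ) : hat t ≤ 1 := by
  unfold hat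
  rcases max_cases (t + 1) 0 with h | h <;> rcases max_cases t 0 with h' | h' <;>
    rcases max_cases (t - 1) 0 with h'' | h'' <;> linarith

lemma hat_eq_zero {t : ℝ} (ht : 1 ≤ |t|) : hat t = 0 := by
  unfold hat
  rcases le_abs.1 ht with ht | ht <;>
  rcases max_cases (t + 1) 0 with h | h <;> rcases max_cases t 0 with h' | h' <;>
    rcases max_cases (t - 1) 0 with h'' | h'' <;> linarith

lemma abs_clamp_le_one (t : ℝ) : |clamp t| ≤ 1 := by
  unfold clamp
  rw [abs_le]
  rcases max_cases (t + 1) 0 with h | h <;>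
    rcases max_cases (t - 1) 0 with h'' | h'' <;> constructor <;> linarith

lemma clamp_eq_self {t : ℝ} (ht : |t| ≤ 1) : clamp t = t := by
  rw [abs_le] at ht
  unfold clamp
  rw [max_eq_left (by linarith), max_eq_right (by linarith)]
  ring

/-- A hat is a difference of consecutive unit ramps, so the sum telescopes. -/
lemma sum_hat (N : ℕ) {y : ℝ} (hy : y ∈ Set.Icc (0 : ℝ) N) :
    ∑ n : Fin (N + 1), hat (y - n) = 1 := by
  have h1 : ∀ n : ℕ, hat (y - n) = (max (y - n + 1) 0 - max (y - n) 0) -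
      (max (y - (n + 1 : ℕ) + 1) 0 - max (y - (n + 1 : ℕ)) 0) := by
    intro n
    unfold hat
    push_cast
    ring_nf
  rw [← Finset.sum_range fun n => hat (y - n)]
  simp_rw [h1]
  rw [Finset.sum_range_sub']
  have h2 := hy.1
  have h3 := hy.2
  push_cast
  rw [max_eq_left (by linarith), max_eq_left (by linarith), max_eq_right (by linarith),
    max_eq_right (by linarith)]
  ring

lemma sum_prod_hat {d : ℕ} (N : ℕ) {x : Fin d → ℝ} (hx : x ∈ Set.Icc (0 : Fin d → ℝ) 1) :
    ∑ n : Fin d → Fin (N + 1), ∏ a, hat (N * x a - n a) = 1 := by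
  have h1 : ∀ a, ∑ i : Fin (N + 1), hat (N * x a - i) = 1 := fun a =>
    sum_hat N ⟨mul_nonneg (Nat.cast_nonneg _) (hx.1 a),
      mul_le_of_le_one_right (Nat.cast_nonneg _) (hx.2 a)⟩
  have h2 := Finset.prod_univ_sum (fun _ : Fin d => (Finset.univ : Finset (Fin (N + 1))))
    fun a i => hat (N * x a - i)
  rw [Fintype.piFinset_univ] at h2
  rw [← h2]
  simp [h1]

lemma card_filter_abs_sub_lt_le (N : ℕ) (y : ℝ) :
    ((Finset.univ : Finset (Fin (N + 1))).filter fun n : Fin (N + 1) => |y - (n : ℝ)| < 1).card ≤ 2 := by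
  refine (Finset.card_le_card_of_injOn (fun n : Fin (N + 1) => ((n : ℕ) : ℤ))
    (t := {⌊y⌋, ⌊y⌋ + 1}) ?_ ?_).trans Finset.card_le_two
  · intro n hn
    have hn : |y - (n : ℝ)| < 1 := by simpa using hn
    rw [abs_lt] at hn
    have h1 := Int.floor_le y
    have h2 := Int.lt_floor_add_one y
    have h3 : ((n : ℕ) : ℤ) < ⌊y⌋ + 2 := by
      have : ((n : ℕ) : ℝ) < ⌊y⌋ + 2 := by linarith
      exact_mod_cast this
    have h4 : ⌊y⌋ - 1 < ((n : ℕ) : ℤ) := by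
      have : (⌊y⌋ : ℝ) - 1 < ((n : ℕ) : ℝ) := by linarith
      exact_mod_cast this
    simp only [Finset.coe_insert, Finset.coe_singleton, Set.mem_insert_iff, Set.mem_singleton_iff]
    omega
  · intro n _ n' _ h
    exact Fin.ext (Int.ofNat.inj h)

lemma card_filter_forall_abs_sub_lt_le {d : ℕ} (N : ℕ) (y : Fin d → ℝ) :
    ((Finset.univ : Finset (Fin d → Fin (N + 1))).filter
      fun n => ∀ a, |y a - (n a : ℝ)| < 1).card ≤ 2 ^ d := by
  have h1 : ((Finset.univ : Finset (Fin d → Fin (N + 1))).filter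
      fun n => ∀ a, |y a - (n a : ℝ)| < 1) = Fintype.piFinset fun a =>
        (Finset.univ : Finset (Fin (N + 1))).filter fun n : Fin (N + 1) => |y a - (n : ℝ)| < 1 := by
    ext n
    simp
  rw [h1, Fintype.card_piFinset]
  calc _ ≤ ∏ _a : Fin d, 2 :=
        Finset.prod_le_prod' fun a _ => card_filter_abs_sub_lt_le N (y a)
    _ = 2 ^ d := by simp

/-- The factors of the localized monomial with index `σ` at the grid point `n / N`. -/
noncomputable def monomialFactor {d r : ℕ} (N : ℕ) (n : Fin d → Fin (N + 1))
    (σ : TaylorIndex d r) (i : ℕ) (x : Fin d → ℝ) : ℝ :=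
  if h : i < d then hat (N * x ⟨i, h⟩ - n ⟨i, h⟩)
  else if h : i - d < σ.1 then clamp (N * x (σ.2 ⟨i - d, h⟩) - n (σ.2 ⟨i - d, h⟩))
  else 1

lemma abs_monomialFactor_le_one {d r : ℕ} (N : ℕ) (n : Fin d → Fin (N + 1))
    (σ : TaylorIndex d r) (i : ℕ) (x : Fin d → ℝ) : |monomialFactor N n σ i x| ≤ 1 := by
  unfold monomialFactor
  split_ifs
  · rw [abs_of_nonneg (hat_nonneg _)]
    exact hat_le_one _
  · exact abs_clamp_le_one _
  · simp

lemma prod_monomialFactor {d r M : ℕ} (hM : d + r ≤ 2 ^ M) (N : ℕ) (n : Fin d → Fin (N + 1))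
    (σ : TaylorIndex d r) (x : Fin d → ℝ) :
    ∏ i ∈ Finset.range (2 ^ M), monomialFactor N n σ i x =
      (∏ a, hat (N * x a - n a)) * ∏ j, clamp (N * x (σ.2 j) - n (σ.2 j)) := by
  have hσ : σ.1.1 ≤ r := Nat.lt_succ_iff.1 σ.1.2
  obtain ⟨e, he⟩ : ∃ e, 2 ^ M = d + (σ.1.1 + e) := ⟨2 ^ M - d - σ.1.1, by omega⟩
  rw [he, Finset.prod_range_add, Finset.prod_range_add, Finset.prod_range, Finset.prod_range]
  have h1 : ∏ i : Fin d, monomialFactor N n σ i x = ∏ a, hat (N * x a - n a) :=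
    Finset.prod_congr rfl fun i _ => by simp [monomialFactor]
  have h2 : ∏ i : Fin σ.1.1, monomialFactor N n σ (d + i) x =
      ∏ j, clamp (N * x (σ.2 j) - n (σ.2 j)) :=
    Finset.prod_congr rfl fun i _ => by simp [monomialFactor]
  have h3 : ∏ i ∈ Finset.range e, monomialFactor N n σ (d + (σ.1.1 + i)) x = 1 :=
    Finset.prod_eq_one fun i _ => by simp [monomialFactor]
  rw [h1, h2, h3, mul_one]

lemma treeProd_monomialFactor_eq_zero {d r M : ℕ} (hM : d + r ≤ 2 ^ M) (k N : ℕ)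
    (n : Fin d → Fin (N + 1)) (σ : TaylorIndex d r) {x : Fin d → ℝ} {a : Fin d}
    (ha : 1 ≤ |(N : ℝ) * x a - n a|) :
    treeProd k M (fun i => monomialFactor N n σ i x) = 0 := by
  refine treeProd_eq_zero k M (i := a) (a.2.trans_le (by omega)) ?_
  simp [monomialFactor, hat_eq_zero ha]

/-- The grid point `n / N`. -/
noncomputable def gridPoint {d : ℕ} (N : ℕ) (n : Fin d → Fin (N + 1)) : Fin d → ℝ :=
  fun a => (n a : ℝ) / N

/-- The network approximation of `f` of mesh size `1 / N`: a partition of unity glues the Taylor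
polynomials at the grid points, with all products replaced by `treeProd`. -/
noncomputable def netApprox {d : ℕ} (r k M N : ℕ) (f : (Fin d → ℝ) → ℝ) (x : Fin d → ℝ) : ℝ :=
  ∑ t : (Fin d → Fin (N + 1)) × TaylorIndex d r,
    (taylorCoeff f (gridPoint N t.1) t.2 * ((N : ℝ)⁻¹) ^ t.2.1.1) *
      treeProd k M fun i => monomialFactor N t.1 t.2 i x

/-- Clamping is the identity where the hats of `n` are active, so it changes nothing here; its role
is to keep the factors in `[-1, 1]` everywhere. The powers of `1/N` come from rescaling the
monomials. -/
lemma prod_hat_mul_taylorPoly {d r : ℕ} {N : ℕ} (hN : 1 ≤ N) (f : (Fin d → ℝ) → ℝ)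
    (n : Fin d → Fin (N + 1)) {x : Fin d → ℝ} (hx : ∀ a, |(N : ℝ) * x a - n a| < 1) :
    (∏ a, hat (N * x a - n a)) * taylorPoly r f (gridPoint N n) x =
      ∑ σ : TaylorIndex d r, (taylorCoeff f (gridPoint N n) σ * ((N : ℝ)⁻¹) ^ σ.1.1) *
        ((∏ a, hat (N * x a - n a)) * ∏ j, clamp (N * x (σ.2 j) - n (σ.2 j))) := by
  have hN0 : (N : ℝ) ≠ 0 := by positivity
  rw [taylorPoly, Finset.mul_sum]
  refine Finset.sum_congr rfl fun σ _ => ?_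
  have h1 : ∏ j, (x (σ.2 j) - gridPoint N n (σ.2 j)) =
      ((N : ℝ)⁻¹) ^ σ.1.1 * ∏ j, clamp (N * x (σ.2 j) - n (σ.2 j)) := by
    have h2 : ∀ j, x (σ.2 j) - gridPoint N n (σ.2 j) =
        (N : ℝ)⁻¹ * clamp (N * x (σ.2 j) - n (σ.2 j)) := fun j => by
      rw [clamp_eq_self (hx _).le, gridPoint]
      field_simp
    simp_rw [h2, Finset.prod_mul_distrib]
    simp
  rw [h1]
  ring

lemma norm_sub_gridPoint_le {d N : ℕ} (hN : 1 ≤ N) {n : Fin d → Fin (N + 1)} {x : Fin d → ℝ}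
    (hx : ∀ a, |(N : ℝ) * x a - n a| < 1) : ‖x - gridPoint N n‖ ≤ (N : ℝ)⁻¹ := by
  have hN0 : (0 : ℝ) < N := by exact_mod_cast hN
  refine (pi_norm_le_iff_of_nonneg (by positivity)).2 fun a => ?_
  have h1 : x a - (n a : ℝ) / N = (N : ℝ)⁻¹ * (N * x a - n a) := by field_simp
  rw [Pi.sub_apply, gridPoint, h1, Real.norm_eq_abs, abs_mul, abs_of_pos (inv_pos.2 hN0)]
  exact mul_le_of_le_one_right (by positivity) (hx a).le

/-- The Taylor errors are averaged with weights summing to `1`. The multiplication errors are not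
weighted, but they vanish exactly except at the at most `2^d` grid points whose hats are active at
`x`; hence no factor depending on `N`. -/
lemma abs_sub_netApprox_le {d r k M N : ℕ} {β : ℝ} (hβ : 0 < β) (hM : d + r ≤ 2 ^ M)
    (hN : 1 ≤ N) (hk : 1 ≤ k) {f : (Fin d → ℝ) → ℝ} (hf : f ∈ holderClass d r β)
    {x : Fin d → ℝ} (hx : x ∈ Set.Icc (0 : Fin d → ℝ) 1) :
    |f x - netApprox r k M N f x| ≤ (d : ℝ) ^ r * ((N : ℝ)⁻¹) ^ ((r : ℝ) + β) +
      2 ^ d * Fintype.card (TaylorIndex d r) * (2 ^ M * (2 / (k : ℝ) ^ 2)) := by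
  classical
  have hα : (0 : ℝ) < (r : ℝ) + β := by positivity
  have hN1 : (N : ℝ)⁻¹ ≤ 1 := inv_le_one_of_one_le₀ (by exact_mod_cast hN)
  set H : (Fin d → Fin (N + 1)) → ℝ := fun n => ∏ a, hat (N * x a - n a) with hH
  set δ : ℝ := (d : ℝ) ^ r * ((N : ℝ)⁻¹) ^ ((r : ℝ) + β) with hδ
  set η : ℝ := Fintype.card (TaylorIndex d r) * (2 ^ M * (2 / (k : ℝ) ^ 2)) with hη
  set Q : (Fin d → Fin (N + 1)) → ℝ := fun n => ∑ σ : TaylorIndex d r,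
    (taylorCoeff f (gridPoint N n) σ * ((N : ℝ)⁻¹) ^ σ.1.1) *
      treeProd k M fun i => monomialFactor N n σ i x with hQ
  have hH0 : ∀ n, 0 ≤ H n := fun n => Finset.prod_nonneg fun _ _ => hat_nonneg _
  have key : ∀ n, |H n * f x - Q n| ≤
      H n * δ + if ∀ a, |(N : ℝ) * x a - n a| < 1 then η else 0 := by
    intro n
    split_ifs with hn
    · have h1 : |H n * (f x - taylorPoly r f (gridPoint N n) x)| ≤ H n * δ := by
        rw [abs_mul, abs_of_nonneg (hH0 n)]
        refine mul_le_mul_of_nonneg_left ((abs_sub_taylorPoly_le hβ hf _ _).trans ?_) (hH0 n)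
        rw [hδ]
        gcongr
        exact norm_sub_gridPoint_le hN hn
      have h2 : |H n * taylorPoly r f (gridPoint N n) x - Q n| ≤ η := by
        rw [hH, prod_hat_mul_taylorPoly hN f n hn, hQ, ← Finset.sum_sub_distrib]
        refine (Finset.abs_sum_le_sum_abs _ _).trans ?_
        calc _ ≤ ∑ _σ : TaylorIndex d r, 2 ^ M * (2 / (k : ℝ) ^ 2) := by
              refine Finset.sum_le_sum fun σ _ => ?_
              rw [← mul_sub, ← prod_monomialFactor hM, abs_mul, abs_mul, abs_sub_comm]
              have h3 := (treeProd_bounds hk M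
                fun i => abs_monomialFactor_le_one N n σ i x).2
              have h4 : |((N : ℝ)⁻¹) ^ σ.1.1| ≤ 1 := by
                rw [abs_of_nonneg (by positivity)]
                exact pow_le_one₀ (by positivity) hN1
              refine (mul_le_of_le_one_left (abs_nonneg _) (mul_le_one₀
                (abs_taylorCoeff_le_one hf _ σ) (abs_nonneg _) h4)).trans (h3.trans ?_)
              gcongr
              linarith
          _ = η := by simp [hη]
      calc |H n * f x - Q n| = |H n * (f x - taylorPoly r f (gridPoint N n) x) +
            (H n * taylorPoly r f (gridPoint N n) x - Q n)| := by
            congr 1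
            ring
        _ ≤ _ := (abs_add_le _ _).trans (add_le_add h1 h2)
    · push Not at hn
      obtain ⟨a, ha⟩ := hn
      have h1 : H n = 0 := Finset.prod_eq_zero (Finset.mem_univ a) (hat_eq_zero ha)
      have h2 : Q n = 0 := Finset.sum_eq_zero fun σ _ => by
        rw [treeProd_monomialFactor_eq_zero hM k N n σ ha, mul_zero]
      simp [h1, h2]
  have hsum : ∑ n, H n = 1 := sum_prod_hat N hx
  have h1 : f x - netApprox r k M N f x = ∑ n, (H n * f x - Q n) := by
    rw [Finset.sum_sub_distrib, ← Finset.sum_mul, hsum, one_mul, netApprox, Fintype.sum_prod_type]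
  rw [h1]
  refine (Finset.abs_sum_le_sum_abs _ _).trans ((Finset.sum_le_sum fun n _ => key n).trans ?_)
  rw [Finset.sum_add_distrib, ← Finset.sum_mul, hsum, one_mul, ← Finset.sum_filter,
    Finset.sum_const, nsmul_eq_mul, mul_assoc]
  have h2 : (((Finset.univ : Finset (Fin d → Fin (N + 1))).filter
      fun n => ∀ a, |(N : ℝ) * x a - (n a : ℝ)| < 1).card : ℝ) ≤ 2 ^ d := by
    exact_mod_cast card_filter_forall_abs_sub_lt_le N fun a => N * x a
  gcongr

/-! ### Cost of the approximation and choice of parameters -/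

namespace NetSpan

variable {d r : ℕ}

/-- The output layer has no bias, so constants come from a hidden unit with bias `1` and zero
weights. -/
lemma one (a : Fin d) {w : ℕ} (hw : 1 ≤ w) : NetSpan d w 1 1 fun _ => 1 := by
  refine (((coord w a).const_mul 0).relu_sum (J := Unit) (by simpa using hw) (B := 1) (by simp)
    (fun _ => 1) (fun _ => 1) (by simp)).mono le_rfl (by simp) |>.congr fun x => ?_
  simp

lemma hat {N : ℕ} (hN : 1 ≤ N) (a : Fin d) (n : Fin (N + 1)) :
    NetSpan d 3 1 (12 * N) fun x => hat (N * x a - n) := by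
  have hN1 : (1 : ℝ) ≤ N := by exact_mod_cast hN
  have hn : (n : ℝ) ≤ N := by exact_mod_cast Nat.lt_succ_iff.1 n.2
  have hn0 : (0 : ℝ) ≤ n := Nat.cast_nonneg _
  -- Inner norm `N`, biases at most `N + 1`, outer coefficients of total size `4`: `4(2N + 1) ≤
  -- 12N`.
  refine ((((coord 3 a).const_mul N).relu_sum (J := Fin 3) (by simp) (B := N + 1)
    (by positivity) ![1, -2, 1] ![-n + 1, -n, -n - 1] fun j => ?_).mono le_rfl ?_).congr
    fun x => ?_
  · rw [abs_le]
    fin_cases j <;> simp <;> constructor <;> linarith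
  · simp [Fin.sum_univ_three]
    linarith
  · simp only [_root_.hat, Fin.sum_univ_three, Matrix.cons_val]
    ring_nf

lemma clamp {N : ℕ} (hN : 1 ≤ N) (a : Fin d) (n : Fin (N + 1)) :
    NetSpan d 3 1 (12 * N) fun x => clamp (N * x a - n) := by
  have hN1 : (1 : ℝ) ≤ N := by exact_mod_cast hN
  have hn : (n : ℝ) ≤ N := by exact_mod_cast Nat.lt_succ_iff.1 n.2
  have hn0 : (0 : ℝ) ≤ n := Nat.cast_nonneg _
  have h := ((coord 2 a).const_mul N).relu_sum (J := Fin 2) (by simp) (B := N + 1)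
    (by positivity) ![1, -1] ![-n + 1, -n - 1] fun j => by
      rw [abs_le]
      fin_cases j <;> simp <;> constructor <;> linarith
  refine ((h.add ((one a le_rfl).const_mul (-1))).mono le_rfl ?_).congr fun x => ?_
  · simp [Fin.sum_univ_two]
    linarith
  · simp only [_root_.clamp, Fin.sum_univ_two, Matrix.cons_val_zero, Matrix.cons_val_one]
    ring_nf

lemma monomialFactor (hd : 1 ≤ d) {N : ℕ} (hN : 1 ≤ N) (n : Fin d → Fin (N + 1))
    (σ : TaylorIndex d r) (i : ℕ) : NetSpan d 3 1 (12 * N) (monomialFactor N n σ i) := by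
  unfold _root_.monomialFactor
  split_ifs
  · exact hat hN _ _
  · exact clamp hN _ _
  · have hN1 : (1 : ℝ) ≤ N := by exact_mod_cast hN
    exact (one ⟨0, hd⟩ (by norm_num)).mono le_rfl (by linarith)

lemma netApprox (hd : 1 ≤ d) {N k : ℕ} (M : ℕ) (hN : 1 ≤ N) (hk : 1 ≤ k) {β : ℝ}
    {f : (Fin d → ℝ) → ℝ} (hf : f ∈ holderClass d r β) :
    NetSpan d ((N + 1) ^ d * Fintype.card (TaylorIndex d r) * (8 ^ M * (3 * k))) (M + 1)
      (((N + 1) ^ d * Fintype.card (TaylorIndex d r) : ℕ) * (16 ^ M * (12 * N)))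
      (netApprox r k M N f) := by
  have hN1 : (1 : ℝ) ≤ N := by exact_mod_cast hN
  have hN2 : (N : ℝ)⁻¹ ≤ 1 := inv_le_one_of_one_le₀ hN1
  have : Nonempty ((Fin d → Fin (N + 1)) × TaylorIndex d r) := ⟨0, ⟨0, Fin.elim0⟩⟩
  have h1 : ∀ t : (Fin d → Fin (N + 1)) × TaylorIndex d r,
      NetSpan d (8 ^ M * (3 * k)) (M + 1) (16 ^ M * (12 * N)) fun x =>
        (taylorCoeff f (gridPoint N t.1) t.2 * ((N : ℝ)⁻¹) ^ t.2.1.1) *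
          _root_.treeProd k M fun i => _root_.monomialFactor N t.1 t.2 i x := by
    intro t
    have h2 := treeProd (w := 3 * k) (L := 1) (C := 12 * N) hk (by omega) (by linarith) M
      fun i => (monomialFactor hd hN t.1 t.2 i).mono (by omega) le_rfl
    rw [add_comm 1 M] at h2
    refine (h2.const_mul _).mono le_rfl (mul_le_of_le_one_left (by positivity) ?_)
    rw [abs_mul]
    refine mul_le_one₀ (abs_taylorCoeff_le_one hf _ _) (abs_nonneg _) ?_
    rw [abs_of_nonneg (by positivity)]
    exact pow_le_one₀ (by positivity) hN2
  have h3 := sum Finset.univ_nonempty fun t _ => h1 t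
  have hcard : (Finset.univ : Finset ((Fin d → Fin (N + 1)) × TaylorIndex d r)).card =
      (N + 1) ^ d * Fintype.card (TaylorIndex d r) := by
    rw [Finset.card_univ, Fintype.card_prod]
    simp
  rw [hcard] at h3
  exact h3

end NetSpan

lemma le_two_pow_ceil_logb {s : ℕ} (hs : 1 ≤ s) : s ≤ 2 ^ ⌈Real.logb 2 s⌉₊ := by
  have hs0 : (0 : ℝ) < s := by exact_mod_cast hs
  have h := (Real.logb_le_iff_le_rpow one_lt_two hs0).1 (Nat.le_ceil (Real.logb 2 s))
  rw [Real.rpow_natCast] at h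
  exact_mod_cast h

lemma exists_zero_net {d W L : ℕ} (hd : 1 ≤ d) (hW : 1 ≤ W) (hL : 1 ≤ L) :
    ∃ θ : ReLUNet 1 d L, θ.width = W ∧ θ.kappa ≤ 0 ∧ ∀ x, θ.toFun x = 0 := by
  obtain ⟨L, rfl⟩ : ∃ L', L = L' + 1 := ⟨L - 1, by omega⟩
  have h := ((NetSpan.one (⟨0, hd⟩ : Fin d) hW).const_mul 0).of_depth_le (Nat.zero_le L)
  obtain ⟨θ, h1, h2, h3⟩ := h.exists_net
  exact ⟨θ, h1, h2.trans (by simp), fun x => by simp [h3]⟩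

/-- Approximation of Hölder functions by networks with a bound on the weights. -/
theorem exists_net_approx {d : ℕ} (hd : 1 ≤ d) (r : ℕ) {β : ℝ} (hβ : 0 < β) :
    ∃ c : ℝ, 0 < c ∧ ∃ C : ℝ, 0 < C ∧ ∀ (K : ℝ) (W L : ℕ), 0 < K →
      c * K ^ ((2 * (d : ℝ) + ((r : ℝ) + β)) / (2 * d + 2)) ≤ (W : ℝ) →
      2 * ⌈Real.logb 2 ((d : ℝ) + r)⌉₊ + 2 ≤ L →
      ∀ f ∈ holderClass d r β, ∃ θ : ReLUNet 1 d L, θ.width = W ∧ θ.kappa ≤ K ∧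
        ∀ x ∈ Set.Icc (0 : Fin d → ℝ) 1,
          |f x - θ.toFun x| ≤ C * K ^ (-(((r : ℝ) + β) / (d + 1))) := by
  set α : ℝ := (r : ℝ) + β with hαdef
  have hα : 0 < α := by positivity
  set M : ℕ := ⌈Real.logb 2 ((d : ℝ) + r)⌉₊ with hMdef
  have hM : d + r ≤ 2 ^ M := by
    have := le_two_pow_ceil_logb (s := d + r) (by omega)
    push_cast at this
    exact this
  set S : ℕ := Fintype.card (TaylorIndex d r) with hS
  have hS1 : 1 ≤ S := Fintype.card_pos_iff.2 ⟨⟨0, Fin.elim0⟩⟩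
  have hS1' : (1 : ℝ) ≤ S := by exact_mod_cast hS1
  set c₁ : ℝ := 2 ^ d * S * (8 ^ M * 6) with hc₁
  set c₂ : ℝ := 2 ^ d * S * (16 ^ M * 12) with hc₂
  have hc₂1 : 1 ≤ c₂ := by
    have h1 : (1 : ℝ) ≤ 2 ^ d := one_le_pow₀ one_le_two
    have h2 : (1 : ℝ) ≤ 16 ^ M := one_le_pow₀ (by norm_num)
    have h3 : (1 : ℝ) ≤ 2 ^ d * S := one_le_mul_of_one_le_of_one_le h1 hS1'
    exact one_le_mul_of_one_le_of_one_le h3 (by linarith)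
  have hc₂0 : 0 < c₂ := by linarith
  set c₃ : ℝ := (d : ℝ) ^ r + 2 ^ d * S * (2 ^ M * 2) with hc₃
  have hc₃0 : 0 ≤ c₃ := by positivity
  refine ⟨c₁, by positivity, (c₃ * 2 ^ α + 1) * c₂ ^ (α / (d + 1)), by positivity,
    fun K W L hK hW hL f hf => ?_⟩
  have hW1 : 1 ≤ W := by
    have : (0 : ℝ) < W := lt_of_lt_of_le (by positivity) hW
    exact_mod_cast this
  have hKC : ∀ y : ℝ, 0 ≤ y → y ^ (-(α / (d + 1))) =
      c₂ ^ (-(α / (d + 1))) * (y / c₂) ^ (-(α / (d + 1))) := fun y hy => by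
    rw [← Real.mul_rpow hc₂0.le (by positivity), mul_div_cancel₀ _ hc₂0.ne']
  have hcc : c₂ ^ (α / (d + 1)) * c₂ ^ (-(α / (d + 1))) = 1 := by
    rw [← Real.rpow_add hc₂0, add_neg_cancel, Real.rpow_zero]
  have hred : (c₃ * 2 ^ α + 1) * c₂ ^ (α / (d + 1)) * K ^ (-(α / (d + 1))) =
      (c₃ * 2 ^ α + 1) * (K / c₂) ^ (-(α / (d + 1))) := by
    rw [hKC K hK.le]
    linear_combination ((c₃ * 2 ^ α + 1) * (K / c₂) ^ (-(α / (d + 1)))) * hcc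
  rw [hred]
  rcases lt_or_ge K c₂ with hlt | hge
  -- For small `K` the claimed error exceeds `1`, so the zero network suffices.
  · obtain ⟨θ, h1, h2, h3⟩ := exists_zero_net (L := L) hd hW1 (by omega)
    refine ⟨θ, h1, h2.trans hK.le, fun x _ => ?_⟩
    rw [h3, sub_zero]
    refine (abs_le_one_of_mem_holderClass hf x).trans ?_
    have h4 : 1 ≤ (K / c₂) ^ (-(α / ((d : ℝ) + 1))) :=
      Real.one_le_rpow_of_pos_of_le_one_of_nonpos (by positivity) ((div_le_one hc₂0).2 hlt.le)
        (neg_nonpos.2 (by positivity))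
    have h5 : 0 ≤ c₃ * 2 ^ α := by positivity
    nlinarith
  -- `R` solves `c₂ R^(d+1) = K`, where `c₂ N^(d+1)` bounds the weight norm for mesh `1/N`.
  · set R : ℝ := (K / c₂) ^ (1 / ((d : ℝ) + 1)) with hR
    have hKc1 : 1 ≤ K / c₂ := (one_le_div hc₂0).2 hge
    have hR1 : 1 ≤ R := Real.one_le_rpow hKc1 (by positivity)
    set N : ℕ := ⌊R⌋₊ with hN
    have hN1 : 1 ≤ N := Nat.le_floor (by simpa using hR1)
    have hN1' : (1 : ℝ) ≤ N := by exact_mod_cast hN1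
    have hNR : (N : ℝ) ≤ R := Nat.floor_le (by linarith)
    have hRN : R ≤ 2 * N := by
      have := Nat.lt_floor_add_one R
      rw [← hN] at this
      linarith
    -- This balances the multiplication error `1/k²` with the Taylor error `N^(-α)`.
    set k : ℕ := ⌈(N : ℝ) ^ (α / 2)⌉₊ with hk
    have hNα1 : (1 : ℝ) ≤ (N : ℝ) ^ (α / 2) := Real.one_le_rpow hN1' (by positivity)
    have hkN : (N : ℝ) ^ (α / 2) ≤ k := Nat.le_ceil _
    have hk1 : 1 ≤ k := by
      have : (1 : ℝ) ≤ k := hNα1.trans hkN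
      exact_mod_cast this
    have hk2 : (k : ℝ) ≤ 2 * (N : ℝ) ^ (α / 2) := by
      have := Nat.ceil_lt_add_one (a := (N : ℝ) ^ (α / 2)) (by positivity)
      rw [← hk] at this
      linarith
    have hcard : (((N + 1) ^ d * S : ℕ) : ℝ) ≤ 2 ^ d * S * (N : ℝ) ^ d := by
      push_cast
      calc ((N : ℝ) + 1) ^ d * S ≤ (2 * N) ^ d * S := by
            gcongr
            linarith
        _ = _ := by ring
    have hwidth : (N + 1) ^ d * S * (8 ^ M * (3 * k)) ≤ W := by
      have h1 : (((N + 1) ^ d * S * (8 ^ M * (3 * k)) : ℕ) : ℝ) ≤ W := by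
        refine le_trans ?_ hW
        rw [Nat.cast_mul]
        have h2 : (N : ℝ) ^ d * (N : ℝ) ^ (α / 2) ≤
            K ^ ((2 * (d : ℝ) + α) / (2 * d + 2)) := by
          have h3 : (0 : ℝ) < N := by linarith
          calc (N : ℝ) ^ d * (N : ℝ) ^ (α / 2) = (N : ℝ) ^ (d + α / 2) := by
                rw [Real.rpow_add h3, Real.rpow_natCast]
            _ ≤ R ^ (d + α / 2) := Real.rpow_le_rpow h3.le hNR (by positivity)
            _ = (K / c₂) ^ ((2 * (d : ℝ) + α) / (2 * d + 2)) := by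
                rw [hR, ← Real.rpow_mul (by positivity)]
                congr 1
                field_simp
            _ ≤ _ := Real.rpow_le_rpow (by positivity) (div_le_self hK.le hc₂1) (by positivity)
        calc _ ≤ (2 ^ d * S * (N : ℝ) ^ d) * (8 ^ M * (3 * (2 * (N : ℝ) ^ (α / 2)))) := by
              push_cast at hcard ⊢
              gcongr
          _ = c₁ * ((N : ℝ) ^ d * (N : ℝ) ^ (α / 2)) := by
              rw [hc₁]
              ring
          _ ≤ _ := by gcongr
      exact_mod_cast h1
    have hgain : (((N + 1) ^ d * S : ℕ) : ℝ) * (16 ^ M * (12 * N)) ≤ K := by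
      calc _ ≤ (2 ^ d * S * (N : ℝ) ^ d) * (16 ^ M * (12 * N)) := by gcongr
        _ = c₂ * (N : ℝ) ^ (d + 1) := by
            rw [hc₂]
            ring
        _ ≤ c₂ * R ^ (d + 1) := by gcongr
        _ = K := by
            rw [hR, ← Real.rpow_natCast, ← Real.rpow_mul (by positivity)]
            push_cast
            rw [one_div_mul_cancel (by positivity), Real.rpow_one, mul_div_cancel₀ _ hc₂0.ne']
    obtain ⟨L, rfl⟩ : ∃ L', L = L' + 1 := ⟨L - 1, by omega⟩
    obtain ⟨θ, h1, h2, h3⟩ := (((NetSpan.netApprox hd M hN1 hk1 hf).mono hwidth hgain).of_depth_le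
      (by omega : M ≤ L)).exists_net
    refine ⟨θ, h1, h2, fun x hx => ?_⟩
    rw [h3]
    refine (abs_sub_netApprox_le hβ hM hN1 hk1 hf hx).trans ?_
    have hk3 : 2 / (k : ℝ) ^ 2 ≤ 2 * ((N : ℝ)⁻¹) ^ α := by
      have h4 : (N : ℝ) ^ α ≤ (k : ℝ) ^ 2 := by
        calc (N : ℝ) ^ α = ((N : ℝ) ^ (α / 2)) ^ 2 := by
              rw [← Real.rpow_natCast, ← Real.rpow_mul (by positivity)]
              congr 1
              push_cast
              ring
          _ ≤ _ := by gcongr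
      rw [Real.inv_rpow (by positivity), div_eq_mul_inv]
      gcongr
    have hNK : ((N : ℝ)⁻¹) ^ α ≤ 2 ^ α * (K / c₂) ^ (-(α / (d + 1))) := by
      have h4 : (N : ℝ)⁻¹ ≤ 2 * R⁻¹ := by
        rw [← div_eq_mul_inv, inv_le_comm₀ (by linarith) (by positivity), inv_div]
        linarith
      calc ((N : ℝ)⁻¹) ^ α ≤ (2 * R⁻¹) ^ α := Real.rpow_le_rpow (by positivity) h4 hα.le
        _ = _ := by
            rw [Real.mul_rpow zero_le_two (by positivity), hR, ← Real.rpow_neg (by positivity),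
              ← Real.rpow_mul (by positivity)]
            congr 2
            field_simp
    calc _ ≤ (d : ℝ) ^ r * ((N : ℝ)⁻¹) ^ α + 2 ^ d * S * (2 ^ M * (2 * ((N : ℝ)⁻¹) ^ α)) := by
          gcongr
      _ = c₃ * ((N : ℝ)⁻¹) ^ α := by
          rw [hc₃]
          ring
      _ ≤ c₃ * (2 ^ α * (K / c₂) ^ (-(α / (d + 1)))) := by gcongr
      _ ≤ _ := by
          have h5 : 0 ≤ (K / c₂) ^ (-(α / ((d : ℝ) + 1))) := by positivity
          linarith

/-! ### Lipschitz bound and homogeneity of `κ` -/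

section Norm

attribute [local instance] Matrix.linftyOpNormedAddCommGroup

lemma Matrix.abs_mulVec_sub_le {m n : Type*} [Fintype m] [Fintype n] (A : Matrix m n ℝ)
    (x y : n → ℝ) (i : m) :
    |A.mulVec x i - A.mulVec y i| ≤ (∑ j, |A i j|) * ‖x - y‖ := by
  simp only [Matrix.mulVec, dotProduct]
  rw [← Finset.sum_sub_distrib, Finset.sum_mul]
  refine (Finset.abs_sum_le_sum_abs _ _).trans (Finset.sum_le_sum fun j _ => ?_)
  rw [← mul_sub, abs_mul]
  exact mul_le_mul_of_nonneg_left (norm_le_pi_norm (x - y) j) (abs_nonneg _)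

namespace ReLUNet

/-- ReLU is `1`-Lipschitz and the row norms bound the Lipschitz constants of the layers for the sup
norm, so `κ` bounds that of the network. -/
lemma norm_eval_sub_le {k m L : ℕ} (θ : ReLUNet k m L) (x y : Fin m → ℝ) :
    ‖θ.eval x - θ.eval y‖ ≤ θ.kappa * ‖x - y‖ := by
  induction θ with
  | output A =>
    refine (pi_norm_le_iff_of_nonneg (mul_nonneg (kappa_nonneg _) (norm_nonneg _))).2 fun i => ?_
    refine (A.abs_mulVec_sub_le x y i).trans ?_
    exact mul_le_mul_of_nonneg_right (A.sum_abs_le_linftyOpNorm i) (norm_nonneg _)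
  | hidden N hN A b θ ih =>
    refine (ih _ _).trans ?_
    rw [kappa, mul_comm (max _ _), mul_assoc]
    refine mul_le_mul_of_nonneg_left ?_ (kappa_nonneg θ)
    refine (pi_norm_le_iff_of_nonneg (by positivity)).2 fun i => ?_
    rw [Pi.sub_apply, Real.norm_eq_abs]
    refine (abs_max_sub_max_le_abs _ _ _).trans ?_
    rw [add_sub_add_right_eq_sub]
    refine (A.abs_mulVec_sub_le x y i).trans (mul_le_mul_of_nonneg_right ?_ (norm_nonneg _))
    refine le_trans ?_ ((Matrix.sum_abs_le_linftyOpNorm _ i).trans (le_max_left _ _))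
    rw [Matrix.sum_abs_fromCols]
    exact le_add_of_nonneg_right (abs_nonneg _)

lemma abs_toFun_sub_le {m L : ℕ} (θ : ReLUNet 1 m L) (x y : Fin m → ℝ) :
    |θ.toFun x - θ.toFun y| ≤ θ.kappa * ‖x - y‖ :=
  (norm_le_pi_norm (θ.eval x - θ.eval y) 0).trans (θ.norm_eval_sub_le x y)

/-- Only the output matrix is scaled. Its norm enters `κ` as a plain factor, without the maximum
with `1`, so `κ` scales down as well as up. -/
lemma exists_smul {k m L : ℕ} (θ : ReLUNet k m L) {t : ℝ} (ht : 0 ≤ t) :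
    ∃ θ' : ReLUNet k m L, θ'.width = θ.width ∧ θ'.kappa ≤ t * θ.kappa ∧
      ∀ x, θ'.eval x = t • θ.eval x := by
  induction θ with
  | output A =>
    refine ⟨.output (t • A), rfl, ?_, fun x => Matrix.smul_mulVec t A x⟩
    rw [kappa, kappa]
    refine Matrix.linftyOpNorm_le (mul_nonneg ht (norm_nonneg _)) fun i => ?_
    simp only [Matrix.smul_apply, smul_eq_mul, abs_mul, abs_of_nonneg ht, ← Finset.mul_sum]
    exact mul_le_mul_of_nonneg_left (A.sum_abs_le_linftyOpNorm i) ht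
  | hidden N hN A b θ ih =>
    obtain ⟨θ', h1, h2, h3⟩ := ih
    refine ⟨.hidden N hN A b θ', by simp only [width, h1], ?_, fun x => h3 _⟩
    rw [kappa, kappa, mul_left_comm]
    exact mul_le_mul_of_nonneg_left h2 (zero_le_one.trans (le_max_right _ _))

end ReLUNet

end Norm

/-! ### The penalized discrepancy against `W₁` and bounded networks -/

section Cube

variable {d : ℕ} {ρ₁ ρ₂ : Measure (Fin d → ℝ)} [IsProbabilityMeasure ρ₁] [IsProbabilityMeasure ρ₂]

lemma integrable_of_continuous_of_cube {ρ : Measure (Fin d → ℝ)} [IsFiniteMeasure ρ]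
    (hρ : ∀ᵐ x ∂ρ, x ∈ Set.Icc (0 : Fin d → ℝ) 1) {f : (Fin d → ℝ) → ℝ} (hf : Continuous f) :
    Integrable f ρ := by
  obtain ⟨B, hB⟩ := (isCompact_Icc (a := (0 : Fin d → ℝ)) (b := 1)).exists_bound_of_continuousOn
    hf.continuousOn
  exact Integrable.of_bound hf.aestronglyMeasurable B (hρ.mono fun x hx => hB x hx)

lemma integral_sub_integral_le_of_abs_sub_le (h₁ : ∀ᵐ x ∂ρ₁, x ∈ Set.Icc (0 : Fin d → ℝ) 1)
    (h₂ : ∀ᵐ x ∂ρ₂, x ∈ Set.Icc (0 : Fin d → ℝ) 1) {f g : (Fin d → ℝ) → ℝ} (hf : Continuous f)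
    (hg : Continuous g) {δ : ℝ} (hfg : ∀ x ∈ Set.Icc (0 : Fin d → ℝ) 1, |f x - g x| ≤ δ) :
    (∫ x, f x ∂ρ₁) - ∫ x, f x ∂ρ₂ ≤ (∫ x, g x ∂ρ₁) - (∫ x, g x ∂ρ₂) + 2 * δ := by
  have key : ∀ (ρ : Measure (Fin d → ℝ)) [IsProbabilityMeasure ρ],
      (∀ᵐ x ∂ρ, x ∈ Set.Icc (0 : Fin d → ℝ) 1) → |(∫ x, f x ∂ρ) - ∫ x, g x ∂ρ| ≤ δ := by
    intro ρ _ h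
    rw [← integral_sub (integrable_of_continuous_of_cube h hf)
      (integrable_of_continuous_of_cube h hg)]
    simpa using norm_integral_le_of_norm_le_const (μ := ρ) (f := fun x => f x - g x)
      (h.mono fun x hx => hfg x hx)
  linarith [(abs_le.1 (key ρ₁ h₁)).2, (abs_le.1 (key ρ₂ h₂)).1]

lemma integral_sub_integral_le_of_lipschitz (h₁ : ∀ᵐ x ∂ρ₁, x ∈ Set.Icc (0 : Fin d → ℝ) 1)
    (h₂ : ∀ᵐ x ∂ρ₂, x ∈ Set.Icc (0 : Fin d → ℝ) 1) {f : (Fin d → ℝ) → ℝ} (hf : Continuous f)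
    {κ : ℝ} (hκ : 0 ≤ κ) (hL : ∀ x y, |f x - f y| ≤ κ * ‖x - y‖) :
    (∫ x, f x ∂ρ₁) - ∫ x, f x ∂ρ₂ ≤ 2 * κ := by
  have h := integral_sub_integral_le_of_abs_sub_le h₁ h₂ hf (continuous_const (y := f 0))
    (δ := κ) fun x hx => by
      refine (hL x 0).trans (mul_le_of_le_one_right hκ ?_)
      rw [sub_zero]
      refine (pi_norm_le_iff_of_nonneg zero_le_one).2 fun a => ?_
      rw [Real.norm_of_nonneg (hx.1 a)]
      exact hx.2 a
  simpa using h

lemma integral_sub_le_wassersteinOne (h₁ : ∀ᵐ x ∂ρ₁, x ∈ Set.Icc (0 : Fin d → ℝ) 1)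
    (h₂ : ∀ᵐ x ∂ρ₂, x ∈ Set.Icc (0 : Fin d → ℝ) 1) {f : (Fin d → ℝ) → ℝ}
    (hf : LipschitzWith 1 f) :
    (∫ x, f x ∂ρ₁) - ∫ x, f x ∂ρ₂ ≤ wassersteinOne ρ₁ ρ₂ := by
  have hb : BddAbove (Set.range fun f : {f : (Fin d → ℝ) → ℝ | LipschitzWith 1 f} =>
      (∫ x, f.1 x ∂ρ₁) - ∫ x, f.1 x ∂ρ₂) := by
    refine ⟨2 * 1, ?_⟩
    rintro _ ⟨f, rfl⟩
    refine integral_sub_integral_le_of_lipschitz h₁ h₂ f.2.continuous zero_le_one fun x y => ?_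
    simpa [Real.dist_eq, dist_eq_norm] using f.2.dist_le_mul x y
  exact le_ciSup hb ⟨f, hf⟩

lemma wassersteinOne_nonneg (h₁ : ∀ᵐ x ∂ρ₁, x ∈ Set.Icc (0 : Fin d → ℝ) 1)
    (h₂ : ∀ᵐ x ∂ρ₂, x ∈ Set.Icc (0 : Fin d → ℝ) 1) : 0 ≤ wassersteinOne ρ₁ ρ₂ := by
  have := integral_sub_le_wassersteinOne h₁ h₂ (LipschitzWith.const' (K := 1) (0 : ℝ))
  simpa using this

lemma ReLUNet.continuous_toFun {L : ℕ} (θ : ReLUNet 1 d L) : Continuous θ.toFun := by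
  refine (LipschitzWith.of_dist_le_mul (K := ⟨θ.kappa, θ.kappa_nonneg⟩) fun x y => ?_).continuous
  rw [Real.dist_eq, dist_eq_norm]
  exact θ.abs_toFun_sub_le x y

lemma ReLUNet.integral_sub_le_kappa_mul {L : ℕ} (θ : ReLUNet 1 d L)
    (h₁ : ∀ᵐ x ∂ρ₁, x ∈ Set.Icc (0 : Fin d → ℝ) 1)
    (h₂ : ∀ᵐ x ∂ρ₂, x ∈ Set.Icc (0 : Fin d → ℝ) 1) :
    (∫ x, θ.toFun x ∂ρ₁) - ∫ x, θ.toFun x ∂ρ₂ ≤ θ.kappa * wassersteinOne ρ₁ ρ₂ := by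
  -- If `κ = 0` the network is constant; otherwise divide it by `κ` to get a `1`-Lipschitz function.
  rcases θ.kappa_nonneg.eq_or_lt with h0 | hpos
  · have := integral_sub_integral_le_of_lipschitz h₁ h₂ θ.continuous_toFun θ.kappa_nonneg
      θ.abs_toFun_sub_le
    rw [← h0, mul_zero] at this
    rwa [← h0, zero_mul]
  · have h := integral_sub_le_wassersteinOne h₁ h₂ (f := fun x => θ.kappa⁻¹ * θ.toFun x)
      (LipschitzWith.of_dist_le_mul fun x y => by
        rw [Real.dist_eq, dist_eq_norm, ← mul_sub, abs_mul, abs_of_pos (inv_pos.2 hpos),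
          NNReal.coe_one, one_mul, inv_mul_le_iff₀ hpos]
        exact θ.abs_toFun_sub_le x y)
    rwa [integral_const_mul, integral_const_mul, ← mul_sub, inv_mul_le_iff₀ hpos] at h

/-- The maximum of `κ W₁ - λκ²` over `κ`, by completing the square. -/
lemma ReLUNet.integral_sub_sub_le {L : ℕ} (θ : ReLUNet 1 d L) {lam : ℝ} (hlam : 0 < lam)
    (h₁ : ∀ᵐ x ∂ρ₁, x ∈ Set.Icc (0 : Fin d → ℝ) 1)
    (h₂ : ∀ᵐ x ∂ρ₂, x ∈ Set.Icc (0 : Fin d → ℝ) 1) :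
    (∫ x, θ.toFun x ∂ρ₁) - (∫ x, θ.toFun x ∂ρ₂) - lam * θ.kappa ^ 2 ≤
      wassersteinOne ρ₁ ρ₂ ^ 2 / (4 * lam) := by
  have h := θ.integral_sub_le_kappa_mul h₁ h₂
  rw [le_div_iff₀ (by positivity)]
  nlinarith [sq_nonneg (wassersteinOne ρ₁ ρ₂ - 2 * lam * θ.kappa)]

lemma ReLUNet.le_penalizedIPM {W L : ℕ} (θ : ReLUNet 1 d L) (hθ : θ.width = W) {lam : ℝ}
    (hlam : 0 < lam) (h₁ : ∀ᵐ x ∂ρ₁, x ∈ Set.Icc (0 : Fin d → ℝ) 1)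
    (h₂ : ∀ᵐ x ∂ρ₂, x ∈ Set.Icc (0 : Fin d → ℝ) 1) :
    (∫ x, θ.toFun x ∂ρ₁) - (∫ x, θ.toFun x ∂ρ₂) - lam * θ.kappa ^ 2 ≤
      penalizedIPM W L lam ρ₁ ρ₂ := by
  -- A real `⨆` over an unbounded family would be the default `0`; the bound by `W₁` makes it a
  -- genuine supremum.
  have hb : BddAbove (Set.range fun θ : {θ : ReLUNet 1 d L // θ.width = W} =>
      (∫ x, θ.1.toFun x ∂ρ₁) - (∫ x, θ.1.toFun x ∂ρ₂) - lam * θ.1.kappa ^ 2) := by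
    refine ⟨wassersteinOne ρ₁ ρ₂ ^ 2 / (4 * lam), ?_⟩
    rintro _ ⟨θ, rfl⟩
    exact θ.1.integral_sub_sub_le hlam h₁ h₂
  exact le_ciSup hb ⟨θ, hθ⟩

lemma penalizedIPM_le {W L : ℕ} (hd : 1 ≤ d) (hW : 1 ≤ W) (hL : 1 ≤ L) {lam : ℝ}
    (hlam : 0 < lam) (h₁ : ∀ᵐ x ∂ρ₁, x ∈ Set.Icc (0 : Fin d → ℝ) 1)
    (h₂ : ∀ᵐ x ∂ρ₂, x ∈ Set.Icc (0 : Fin d → ℝ) 1) :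
    penalizedIPM W L lam ρ₁ ρ₂ ≤ wassersteinOne ρ₁ ρ₂ ^ 2 / (4 * lam) := by
  obtain ⟨θ, hθ, -⟩ := exists_zero_net (W := W) (L := L) hd hW hL
  have : Nonempty {θ : ReLUNet 1 d L // θ.width = W} := ⟨⟨θ, hθ⟩⟩
  exact ciSup_le fun θ => θ.1.integral_sub_sub_le hlam h₁ h₂

lemma penalizedIPM_nonneg {W L : ℕ} (hd : 1 ≤ d) (hW : 1 ≤ W) (hL : 1 ≤ L) {lam : ℝ}
    (hlam : 0 < lam) (h₁ : ∀ᵐ x ∂ρ₁, x ∈ Set.Icc (0 : Fin d → ℝ) 1)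
    (h₂ : ∀ᵐ x ∂ρ₂, x ∈ Set.Icc (0 : Fin d → ℝ) 1) : 0 ≤ penalizedIPM W L lam ρ₁ ρ₂ := by
  obtain ⟨θ, hθ, hκ, h0⟩ := exists_zero_net (W := W) (L := L) hd hW hL
  have h := θ.le_penalizedIPM hθ hlam h₁ h₂
  simpa [h0, le_antisymm hκ θ.kappa_nonneg] using h

/-- By homogeneity, the penalized discrepancy controls networks with bounded weights. -/
lemma ReLUNet.integral_sub_le_sqrt_penalizedIPM {W L : ℕ} (θ : ReLUNet 1 d L)
    (hθ : θ.width = W) {K : ℝ} (hK : 0 < K) (hκ : θ.kappa ≤ K)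
    (h₁ : ∀ᵐ x ∂ρ₁, x ∈ Set.Icc (0 : Fin d → ℝ) 1)
    (h₂ : ∀ᵐ x ∂ρ₂, x ∈ Set.Icc (0 : Fin d → ℝ) 1) :
    (∫ x, θ.toFun x ∂ρ₁) - (∫ x, θ.toFun x ∂ρ₂) ≤
      √(penalizedIPM W L (1 / (4 * K ^ 2)) ρ₁ ρ₂) := by
  set D := (∫ x, θ.toFun x ∂ρ₁) - ∫ x, θ.toFun x ∂ρ₂ with hD
  rcases le_or_gt D 0 with h | h
  · exact h.trans (Real.sqrt_nonneg _)
  refine Real.le_sqrt_of_sq_le ?_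
  -- `t = 2D` maximizes `tD - t²K² / (4K²)`, with maximum `D²`.
  obtain ⟨θ', h3, h4, h5⟩ := θ.exists_smul (t := 2 * D) (by positivity)
  have h6 : ∀ x, θ'.toFun x = 2 * D * θ.toFun x := fun x => by
    simp [toFun, h5]
  have h7 := θ'.le_penalizedIPM (h3.trans hθ) (lam := 1 / (4 * K ^ 2)) (by positivity) h₁ h₂
  simp_rw [h6, integral_const_mul, ← mul_sub] at h7
  rw [← hD] at h7
  have h8 : θ'.kappa ^ 2 ≤ (2 * D * K) ^ 2 := by
    refine pow_le_pow_left₀ θ'.kappa_nonneg (h4.trans ?_) 2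
    gcongr
  have h9 : 1 / (4 * K ^ 2) * θ'.kappa ^ 2 ≤ D ^ 2 := by
    calc _ ≤ 1 / (4 * K ^ 2) * (2 * D * K) ^ 2 := by gcongr
      _ = D ^ 2 := by
        field_simp
        ring
  nlinarith

end Cube

section Ipm

variable {d r : ℕ} {β : ℝ} {μ ρ : Measure (Fin d → ℝ)}

lemma abs_integral_le_one_of_mem_holderClass [IsProbabilityMeasure μ] {f : (Fin d → ℝ) → ℝ}
    (hf : f ∈ holderClass d r β) : |∫ x, f x ∂μ| ≤ 1 := by
  simpa using norm_integral_le_of_norm_le_const (μ := μ) (f := f)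
    (.of_forall (abs_le_one_of_mem_holderClass hf))

lemma ipm_holderClass_le {B : ℝ}
    (h : ∀ f ∈ holderClass d r β, (∫ x, f x ∂μ) - ∫ x, f x ∂ρ ≤ B) :
    ipm (holderClass d r β) μ ρ ≤ B := by
  have : Nonempty (holderClass d r β) := ⟨⟨_, zero_mem_holderClass⟩⟩
  exact ciSup_le fun f => h f.1 f.2

lemma abs_ipm_holderClass_le [IsProbabilityMeasure μ] [IsProbabilityMeasure ρ] :
    |ipm (holderClass d r β) μ ρ| ≤ 2 := by
  have hle : ∀ f ∈ holderClass d r β, (∫ x, f x ∂μ) - ∫ x, f x ∂ρ ≤ 2 := fun f hf => by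
    linarith [(abs_le.1 (abs_integral_le_one_of_mem_holderClass (μ := μ) hf)).2,
      (abs_le.1 (abs_integral_le_one_of_mem_holderClass (μ := ρ) hf)).1]
  have hb : BddAbove (Set.range fun f : holderClass d r β =>
      (∫ x, f.1 x ∂μ) - ∫ x, f.1 x ∂ρ) := ⟨2, by
    rintro _ ⟨f, rfl⟩
    exact hle f.1 f.2⟩
  have h0 : 0 ≤ ipm (holderClass d r β) μ ρ := by
    have := le_ciSup hb ⟨_, zero_mem_holderClass⟩
    simpa [ipm] using this
  rw [abs_of_nonneg h0]
  exact ipm_holderClass_le hle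

end Ipm

lemma ae_mem_cube_map {d k : ℕ} {ν : Measure (Fin k → ℝ)} {g : (Fin k → ℝ) → (Fin d → ℝ)}
    (hg : Measurable g) (hg' : ∀ z, g z ∈ Set.Icc (0 : Fin d → ℝ) 1) :
    ∀ᵐ x ∂ν.map g, x ∈ Set.Icc (0 : Fin d → ℝ) 1 :=
  (ae_map_iff hg.aemeasurable measurableSet_Icc).2 (.of_forall hg')

lemma ae_mem_cube_empiricalMeasure {d n : ℕ} {x : Fin n → Fin d → ℝ}
    (hx : ∀ i, x i ∈ Set.Icc (0 : Fin d → ℝ) 1) :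
    ∀ᵐ y ∂empiricalMeasure x, y ∈ Set.Icc (0 : Fin d → ℝ) 1 := by
  refine mem_ae_iff.2 ?_
  change empiricalMeasure x (Set.Icc (0 : Fin d → ℝ) 1)ᶜ = 0
  have : ∀ i, Measure.dirac (x i) (Set.Icc (0 : Fin d → ℝ) 1)ᶜ = 0 := fun i => by
    rw [Measure.dirac_apply' _ measurableSet_Icc.compl]
    simpa using hx i
  simp [empiricalMeasure, this]

/-- If the generators approximate a measure arbitrarily well, then the infimum of the penalized
discrepancies vanishes. -/
lemma iInf_penalizedIPM_nonpos {d k W L : ℕ} (hd : 1 ≤ d) (hW : 1 ≤ W) (hL : 1 ≤ L) {lam : ℝ}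
    (hlam : 0 < lam) {ρ : Measure (Fin d → ℝ)} [IsProbabilityMeasure ρ]
    (hρ : ∀ᵐ x ∂ρ, x ∈ Set.Icc (0 : Fin d → ℝ) 1) {ν : Measure (Fin k → ℝ)}
    [IsProbabilityMeasure ν] {G : Set ((Fin k → ℝ) → (Fin d → ℝ))} (hGne : G.Nonempty)
    (hG : ∀ g ∈ G, Measurable g ∧ ∀ z, g z ∈ Set.Icc (0 : Fin d → ℝ) 1)
    (hinf : (⨅ g : G, wassersteinOne ρ (ν.map g.1)) = 0) :
    (⨅ g : G, penalizedIPM W L lam ρ (ν.map g.1)) ≤ 0 := by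
  have : Nonempty G := hGne.to_subtype
  have hcube : ∀ g : G, ∀ᵐ x ∂ν.map g.1, x ∈ Set.Icc (0 : Fin d → ℝ) 1 := fun g =>
    ae_mem_cube_map (hG g.1 g.2).1 (hG g.1 g.2).2
  have hprob : ∀ g : G, IsProbabilityMeasure (ν.map g.1) := fun g =>
    Measure.isProbabilityMeasure_map (hG g.1 g.2).1.aemeasurable
  have hbdd : BddBelow (Set.range fun g : G => penalizedIPM W L lam ρ (ν.map g.1)) := by
    refine ⟨0, ?_⟩
    rintro _ ⟨g, rfl⟩
    exact penalizedIPM_nonneg hd hW hL hlam hρ (hcube g)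
  refine le_of_forall_pos_le_add fun δ hδ => ?_
  rw [zero_add]
  -- The threshold is chosen so that `W₁² / (4λ) ≤ δ`.
  obtain ⟨g, hg⟩ := exists_lt_of_ciInf_lt (f := fun g : G => wassersteinOne ρ (ν.map g.1))
    (a := √(4 * lam * δ)) (by rw [hinf]; positivity)
  refine (ciInf_le hbdd g).trans ((penalizedIPM_le hd hW hL hlam hρ (hcube g)).trans ?_)
  rw [div_le_iff₀ (by positivity)]
  calc wassersteinOne ρ (ν.map g.1) ^ 2 ≤ √(4 * lam * δ) ^ 2 :=
        pow_le_pow_left₀ (wassersteinOne_nonneg hρ (hcube g)) hg.le 2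
    _ = δ * (4 * lam) := by
        rw [Real.sq_sqrt (by positivity)]
        ring

/-! ### Assembly of the error bound -/

theorem corollary4p9 (d : ℕ) (hd : 1 ≤ d) (r : ℕ) (β : ℝ) (hβ0 : 0 < β) (hβ1 : β ≤ 1)
    (α : ℝ) (hα : α = r + β) :
    ∃ c : ℝ, 0 < c ∧ ∀ a b : ℝ, 0 < a → a ≤ b → ∃ C : ℝ, 0 < C ∧
      ∀ (n : ℕ), 1 ≤ n → ∀ (W L : ℕ) (K lam : ℝ),
        a * (n : ℝ) ^ (((d : ℝ) + 1) / d) ≤ K → K ≤ b * (n : ℝ) ^ (((d : ℝ) + 1) / d) →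
        c * K ^ ((2 * (d : ℝ) + α) / (2 * d + 2)) ≤ (W : ℝ) →
        2 * ⌈Real.logb 2 ((d : ℝ) + r)⌉₊ + 2 ≤ L →
        lam = 1 / (4 * K ^ 2) →
        -- the source distribution and the generator class
        ∀ (k : ℕ) (ν : Measure (Fin k → ℝ)) [IsProbabilityMeasure ν]
          (G : Set ((Fin k → ℝ) → (Fin d → ℝ))),
          (∀ g ∈ G, Measurable g ∧ ∀ z, g z ∈ Set.Icc (0 : Fin d → ℝ) 1) →
        -- the target distribution and the sample
        ∀ (μ : Measure (Fin d → ℝ)) [IsProbabilityMeasure μ],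
          μ (Set.Icc (0 : Fin d → ℝ) 1)ᶜ = 0 →
        ∀ (Ω : Type*) [MeasurableSpace Ω] (P : Measure Ω) [IsProbabilityMeasure P]
          (X : Fin n → Ω → (Fin d → ℝ)),
          (∀ i, HasLaw (X i) μ P) → iIndepFun X P →
          (∀ᵐ ω ∂P, (⨅ g : G, wassersteinOne (empiricalMeasure fun i => X i ω) (ν.map g.1)) = 0) →
        -- the estimator and its optimization error
        ∀ (ε : ℝ), 0 ≤ ε → ∀ (gHat : Ω → (Fin k → ℝ) → (Fin d → ℝ)),
          (∀ᵐ ω ∂P, gHat ω ∈ G ∧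
            penalizedIPM W L lam (empiricalMeasure fun i => X i ω) (ν.map (gHat ω)) ≤
              (⨅ g : G, penalizedIPM W L lam (empiricalMeasure fun i => X i ω) (ν.map g.1)) + ε) →
          AEMeasurable (fun ω => ipm (holderClass d r β) μ (ν.map (gHat ω))) P →
        (1 / (4 * b ^ 2) * (n : ℝ) ^ (-(2 * ((d : ℝ) + 1) / d)) ≤ lam ∧
          lam ≤ 1 / (4 * a ^ 2) * (n : ℝ) ^ (-(2 * ((d : ℝ) + 1) / d))) ∧
        Integrable (fun ω => ipm (holderClass d r β) μ (ν.map (gHat ω))) P ∧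
        (∫ ω, ipm (holderClass d r β) μ (ν.map (gHat ω)) ∂P) - √ε ≤
          C * max ((n : ℝ) ^ (-(α / d)))
            ((n : ℝ) ^ (-(1 / 2 : ℝ)) * Real.log n ^ (if 2 * α = d then (1 : ℕ) else 0)) := by
  subst hα
  have hα0 : (0 : ℝ) < (r : ℝ) + β := by positivity
  have hd0 : (0 : ℝ) < d := by exact_mod_cast hd
  obtain ⟨c, hc, C₁, hC₁, happrox⟩ := exists_net_approx hd r hβ0
  obtain ⟨C₂, hC₂, hemp⟩ := exists_integrable_deviation_bound hd r hβ0
  refine ⟨c, hc, fun a b ha hab => ?_⟩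
  -- `C₂` pays for sampling; the rest is twice the approximation error, as `f` is replaced by a
  -- network under two measures.
  refine ⟨C₂ + 2 * (C₁ * a ^ (-(((r : ℝ) + β) / (d + 1)))), by positivity, ?_⟩
  intro n hn W L K lam hKa hKb hW hL hlam k ν _ G hG μ _ hμ Ω _ P _ X hX hi hinf ε hε gHat hgHat
    hmeas
  have hn0 : (0 : ℝ) < n := by exact_mod_cast hn
  have hb : 0 < b := ha.trans_le hab
  have hK : 0 < K := lt_of_lt_of_le (by positivity) hKa
  have hlam0 : 0 < lam := by rw [hlam]; positivity
  have hW1 : 1 ≤ W := by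
    have : (0 : ℝ) < W := lt_of_lt_of_le (by positivity) hW
    exact_mod_cast this
  have hsq : ∀ y : ℝ, (y * (n : ℝ) ^ (((d : ℝ) + 1) / d)) ^ 2 =
      y ^ 2 * (n : ℝ) ^ (2 * ((d : ℝ) + 1) / d) := fun y => by
    rw [mul_pow, ← Real.rpow_natCast (_ ^ _) 2, ← Real.rpow_mul hn0.le]
    congr 2
    push_cast
    ring
  have hinv : ∀ y : ℝ, 1 / (4 * y ^ 2) * (n : ℝ) ^ (-(2 * ((d : ℝ) + 1) / d)) =
      1 / (4 * (y * (n : ℝ) ^ (((d : ℝ) + 1) / d)) ^ 2) := fun y => by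
    rw [hsq, Real.rpow_neg hn0.le, ← mul_assoc, one_div, one_div, ← mul_inv]
  have hX01 : ∀ᵐ ω ∂P, ∀ i, X i ω ∈ Set.Icc (0 : Fin d → ℝ) 1 := by
    rw [ae_all_iff]
    intro i
    have h := mem_ae_iff.2 hμ
    rw [← (hX i).map_eq] at h
    exact ae_of_ae_map (hX i).aemeasurable h
  -- Only almost surely, since the estimator is known to lie in `G`, hence to be measurable, only
  -- almost surely.
  have hprob : ∀ᵐ ω ∂P, IsProbabilityMeasure (ν.map (gHat ω)) := by
    filter_upwards [hgHat] with ω hω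
    exact Measure.isProbabilityMeasure_map (hG _ hω.1).1.aemeasurable
  have hint : Integrable (fun ω => ipm (holderClass d r β) μ (ν.map (gHat ω))) P := by
    refine Integrable.of_bound hmeas.aestronglyMeasurable 2 ?_
    filter_upwards [hprob] with ω hω
    exact abs_ipm_holderClass_le
  refine ⟨⟨?_, ?_⟩, hint, ?_⟩
  · rw [hinv, hlam]
    gcongr
  · rw [hinv, hlam]
    gcongr
  obtain ⟨Z, hZi, hZ, hZdom⟩ := hemp n hn μ hμ Ω P X hX hi
  set δ : ℝ := C₁ * K ^ (-(((r : ℝ) + β) / (d + 1))) with hδ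
  have hdom : ∀ᵐ ω ∂P, ipm (holderClass d r β) μ (ν.map (gHat ω)) ≤ Z ω + (2 * δ + √ε) := by
    filter_upwards [hX01, hprob, hgHat, hinf] with ω h01 hpr hg hinf
    have := isProbabilityMeasure_empiricalMeasure hn fun i => X i ω
    have hcube₁ := ae_mem_cube_empiricalMeasure h01
    have hcube₂ := ae_mem_cube_map (ν := ν) (hG _ hg.1).1 (hG _ hg.1).2
    refine ipm_holderClass_le fun f hf => ?_
    obtain ⟨θ, hθW, hθK, hθ⟩ := happrox K W L hK hW hL f hf
    have h1 := hZdom ω h01 f hf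
    have h2 := integral_sub_integral_le_of_abs_sub_le hcube₁ hcube₂
      (continuous_of_mem_holderClass hf) θ.continuous_toFun hθ
    have h3 := θ.integral_sub_le_sqrt_penalizedIPM hθW hK hθK hcube₁ hcube₂
    have h4 := iInf_penalizedIPM_nonpos (W := W) (L := L) hd hW1 (by omega) hlam0 hcube₁
      ⟨_, hg.1⟩ hG hinf
    have h5 : √(penalizedIPM W L (1 / (4 * K ^ 2)) (empiricalMeasure fun i => X i ω)
        (ν.map (gHat ω))) ≤ √ε := by
      rw [← hlam]
      exact Real.sqrt_le_sqrt (by linarith [hg.2])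
    linarith
  -- From `K ≥ a n^((d+1)/d)` and a negative exponent: `K^(-α/(d+1)) ≤ a^(-α/(d+1)) n^(-α/d)`.
  have hδn : δ ≤ C₁ * a ^ (-(((r : ℝ) + β) / (d + 1))) * (n : ℝ) ^ (-(((r : ℝ) + β) / d)) := by
    rw [hδ, mul_assoc]
    gcongr
    calc K ^ (-(((r : ℝ) + β) / (d + 1))) ≤
          (a * (n : ℝ) ^ (((d : ℝ) + 1) / d)) ^ (-(((r : ℝ) + β) / (d + 1))) :=
          Real.rpow_le_rpow_of_nonpos (by positivity) hKa (neg_nonpos.2 (by positivity))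
      _ = _ := by
          rw [Real.mul_rpow ha.le (by positivity), ← Real.rpow_mul hn0.le]
          congr 2
          field_simp
  have hle : ∫ ω, ipm (holderClass d r β) μ (ν.map (gHat ω)) ∂P ≤
      (∫ ω, Z ω ∂P) + (2 * δ + √ε) := by
    refine (integral_mono_ae hint
      (hZi.add (integrable_const (2 * δ + √ε))) hdom).trans (le_of_eq ?_)
    rw [integral_add' hZi (integrable_const _), integral_const, probReal_univ, one_smul]
  change _ ≤ _ * empiricalRate d ((r : ℝ) + β) n
  have hrate := mul_le_mul_of_nonneg_left (rpow_le_empiricalRate d ((r : ℝ) + β) n)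
    (by positivity : 0 ≤ C₁ * a ^ (-(((r : ℝ) + β) / ((d : ℝ) + 1))))
  linarith
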